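/- Let $(X,\mathcal X,\mu)$ be a measure space and let $(\mathcal E,\mathcal F)$ be a symmetric Dirichlet form on $L_2(X,\mu,\mathbb R)$, i.e. a densely defined, nonnegative, symmetric, closed bilinear form such that $u\in\mathcal F$ implies $\min(u,1)\in\mathcal F$ and $\mathcal E(\min(u,1),\min(u,1))\le\mathcal E(u,u)$. Let $\mathcal B(\mathcal E)$ be the algebra of all bounded measurable functions $f:X\to\mathbb R$ whose $\mu$-equivalence class lies in $\mathcal F\cap L_1(X,\mu,\mathbb R)$. Assume that $\mathcal B(\mathcal E)$ vanishes nowhere on $X$ (for each $x\in X$ there is $f\in\mathcal B(\mathcal E)$ with $f(x)\ne0$) and is separable with respect to the supremum norm. Let $A$ be the closure of the complexification $\mathcal B(\mathcal E)+i\,\mathcal B(\mathcal E)$ in the supremum norm, a commutative $C^*$-algebra, and let $\Delta$ be its spectrum, i.e. the set of nonzero continuous multiplicative linear functionals $\chi:A\to\mathbb C$ with the topology of pointwise convergence. For $f\in\mathcal B(\mathcal E)$ let $\hat f\in C_0(\Delta,\mathbb R)$, $\hat f(\chi)=\chi(f)$, be its Gelfand transform, put $\hat{\mathcal B}(\mathcal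 E)=\{\hat f: f\in\mathcal B(\mathcal E)\}$, and define $\hat{\mathcal E}(\hat f,\hat g)=\mathcal E(f,g)$ for $f,g\in\mathcal B(\mathcal E)$. Then for every $\hat f\in\hat{\mathcal B}(\mathcal E)$ there exists a unique finite nonnegative Radon measure $\hat\Gamma(\hat f)$ on $\Delta$ such that $$2\int_\Delta\hat\varphi\,d\hat\Gamma(\hat f)=2\hat{\mathcal E}(\hat\varphi\hat f,\hat f)-\hat{\mathcal E}(\hat\varphi,\hat f^2)\qquad\text{for all }\hat\varphi\in\hat{\mathcal B}(\mathcal E).$$ The original form need not have energy measures: there exist a measure space $(X,\mathcal X,\mu)$ and a symmetric Dirichlet form $(\mathcal E,\mathcal F)$ on $L_2(X,\mu,\mathbb R)$ satisfying the above assumptions for which it is not the case that for every $f\in\mathcal B(\mathcal E)$ there is a nonnegative measure $\Gamma(f)$ on $(X,\mathcal X)$ such that every $\varphi\in\mathcal B(\mathcal E)$ is $\Gamma(f)$-integrable and $2\int_X\varphi\,d\Gamma(f)=2\mathcal E(\varphi f,f)-\mathcal E(\varphi,f^2)$. -/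

import Mathlib

open MeasureTheory Filter Topology
open scoped ENNReal ZeroAtInfty

/-- A (symmetric) Dirichlet form on the real space `L²(X, μ)` over an arbitrary measure space:
a densely defined, nonnegative, symmetric bilinear form that is closed (its domain is complete
for the norm `(form u u + ‖u‖²)^(1/2)`) and Markovian (`u ↦ min u 1` operates on it). -/
structure DirichletForm {X : Type*} [MeasurableSpace X] (μ : Measure X) where
  domain : Submodule ℝ (Lp ℝ 2 μ)
  form : domain →ₗ[ℝ] domain →ₗ[ℝ] ℝ
  symm : ∀ u v, form u v = form v u
  nonneg : ∀ u, 0 ≤ form u u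
  dense : Dense (domain : Set (Lp ℝ 2 μ))
  closed : ∀ u : ℕ → domain,
    (∀ ε > 0, ∃ N, ∀ m ≥ N, ∀ n ≥ N,
      form (u m - u n) (u m - u n) + ‖((u m - u n : domain) : Lp ℝ 2 μ)‖ ^ 2 < ε) →
    ∃ v : domain, Tendsto
      (fun n => form (u n - v) (u n - v) + ‖((u n - v : domain) : Lp ℝ 2 μ)‖ ^ 2) atTop (𝓝 0)
  markov : ∀ u : domain, ∃ v : domain,
    ((v : Lp ℝ 2 μ) =ᵐ[μ] fun x => min ((u : Lp ℝ 2 μ) x) 1) ∧ form v v ≤ form u u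

namespace DirichletForm

variable {X : Type*} [MeasurableSpace X] {μ : Measure X} (𝓔 : DirichletForm μ)

/-! ### Products of bounded functions of finite energy -/

theorem form_add_le {a b : 𝓔.domain} {s t : ℝ} (hs : 0 ≤ s) (ht : 0 ≤ t)
    (ha : 𝓔.form a a ≤ s ^ 2) (hb : 𝓔.form b b ≤ t ^ 2) :
    𝓔.form (a + b) (a + b) ≤ (s + t) ^ 2 := by
  have h := LinearMap.BilinForm.apply_mul_apply_le_of_forall_zero_le 𝓔.form 𝓔.nonneg a b
  rw [𝓔.symm b a] at h
  have h2 : 𝓔.form a b ≤ s * t := by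
    refine le_of_abs_le (abs_le_of_sq_le_sq ?_ (mul_nonneg hs ht))
    calc 𝓔.form a b ^ 2 ≤ 𝓔.form a a * 𝓔.form b b := by rw [sq]; exact h
      _ ≤ s ^ 2 * t ^ 2 := by
        apply mul_le_mul ha hb (𝓔.nonneg b) (by positivity)
      _ = (s * t) ^ 2 := by ring
  simp only [map_add, LinearMap.add_apply]
  rw [𝓔.symm b a]
  nlinarith

theorem form_neg (a : 𝓔.domain) : 𝓔.form (-a) (-a) = 𝓔.form a a := by simp

theorem form_smul (c : ℝ) (a : 𝓔.domain) : 𝓔.form (c • a) (c • a) = c ^ 2 * 𝓔.form a a := by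
  simp [sq, mul_assoc]

theorem form_parallelogram (a b : 𝓔.domain) :
    𝓔.form (a - b) (a - b) =
      2 * 𝓔.form a a + 2 * 𝓔.form b b
        - 4 * 𝓔.form ((1 / 2 : ℝ) • (a + b)) ((1 / 2 : ℝ) • (a + b)) := by
  simp only [map_add, map_sub, LinearMap.sub_apply, LinearMap.add_apply, map_smul,
    LinearMap.smul_apply, smul_eq_mul]
  rw [𝓔.symm b a]
  ring

/-- An `L²`-limit of elements of bounded energy belongs to the domain. -/
theorem mem_domain_of_approx (v : Lp ℝ 2 μ) (C : ℝ)
    (h : ∀ δ > 0, ∃ w : 𝓔.domain, 𝓔.form w w ≤ C ∧ ‖(w : Lp ℝ 2 μ) - v‖ ≤ δ) :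
    v ∈ 𝓔.domain := by
  let K : ℕ → Set 𝓔.domain := fun n => {w | ‖(w : Lp ℝ 2 μ) - v‖ ≤ 1 / ((n : ℝ) + 1)}
  let S : ℕ → Set ℝ := fun n => (fun w => 𝓔.form w w) '' K n
  have hS0 : ∀ n, BddBelow (S n) := fun n => ⟨0, by rintro _ ⟨w, -, rfl⟩; exact 𝓔.nonneg w⟩
  have hSne : ∀ n, (S n).Nonempty := fun n => by
    obtain ⟨w, -, hw⟩ := h (1 / ((n : ℝ) + 1)) (by positivity)
    exact ⟨_, w, hw, rfl⟩
  let α : ℕ → ℝ := fun n => sInf (S n)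
  have hαC : ∀ n, α n ≤ C := fun n => by
    obtain ⟨w, hw1, hw⟩ := h (1 / ((n : ℝ) + 1)) (by positivity)
    exact (csInf_le (hS0 n) ⟨w, hw, rfl⟩).trans hw1
  have hanti : ∀ {m n : ℕ}, m ≤ n → (1 : ℝ) / ((n : ℝ) + 1) ≤ 1 / ((m : ℝ) + 1) :=
    fun hmn => one_div_le_one_div_of_le (by positivity) (by exact_mod_cast Nat.succ_le_succ hmn)
  have hαle : ∀ n, ∀ w ∈ K n, α n ≤ 𝓔.form w w := fun n w hw => csInf_le (hS0 n) ⟨w, hw, rfl⟩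
  have hbdd : BddAbove (Set.range α) := ⟨C, by rintro _ ⟨n, rfl⟩; exact hαC n⟩
  let A : ℝ := ⨆ n, α n
  have hαA : ∀ n, α n ≤ A := fun n => le_ciSup hbdd n
  have hex : ∀ n : ℕ, ∃ w ∈ K n, 𝓔.form w w < A + 1 / ((n : ℝ) + 1) := fun n => by
    have hlt : sInf (S n) < A + 1 / ((n : ℝ) + 1) :=
      (hαA n).trans_lt (lt_add_of_pos_right _ (by positivity))
    obtain ⟨_, ⟨w, hw, rfl⟩, hlt'⟩ := exists_lt_of_csInf_lt (hSne n) hlt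
    exact ⟨w, hw, hlt'⟩
  choose w hwK hwA using hex
  have hsmall : ∀ ε > (0 : ℝ), ∃ N : ℕ, ∀ n ≥ N, (1 : ℝ) / ((n : ℝ) + 1) < ε := fun ε hε => by
    obtain ⟨N, hN⟩ := exists_nat_one_div_lt hε
    exact ⟨N, fun n hn => (hanti hn).trans_lt hN⟩
  have hcauchy : ∀ ε > 0, ∃ N, ∀ m ≥ N, ∀ n ≥ N,
      𝓔.form (w m - w n) (w m - w n)
        + ‖((w m - w n : 𝓔.domain) : Lp ℝ 2 μ)‖ ^ 2 < ε := by
    intro ε hε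
    obtain ⟨N₁, hN₁⟩ : ∃ N₁, A - ε / 24 < α N₁ :=
      exists_lt_of_lt_ciSup (by linarith : A - ε / 24 < ⨆ n, α n)
    obtain ⟨N₂, hN₂⟩ := hsmall (min (ε / 24) 1) (by positivity)
    refine ⟨max N₁ N₂, fun m hm n hn => ?_⟩
    have hm1 : N₁ ≤ m := (le_max_left _ _).trans hm
    have hn1 : N₁ ≤ n := (le_max_left _ _).trans hn
    have hm2 := hN₂ m ((le_max_right _ _).trans hm)
    have hn2 := hN₂ n ((le_max_right _ _).trans hn)
    have hmK : ‖(w m : Lp ℝ 2 μ) - v‖ ≤ 1 / ((m : ℝ) + 1) := hwK m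
    have hnK : ‖(w n : Lp ℝ 2 μ) - v‖ ≤ 1 / ((n : ℝ) + 1) := hwK n
    have hmid : (1 / 2 : ℝ) • (w m + w n) ∈ K N₁ := by
      change ‖(((1 / 2 : ℝ) • (w m + w n) : 𝓔.domain) : Lp ℝ 2 μ) - v‖ ≤ _
      have : (((1 / 2 : ℝ) • (w m + w n) : 𝓔.domain) : Lp ℝ 2 μ) - v
          = (1 / 2 : ℝ) • (((w m : Lp ℝ 2 μ) - v) + ((w n : Lp ℝ 2 μ) - v)) := by
        push_cast
        module
      rw [this, norm_smul]
      have h3 := norm_add_le ((w m : Lp ℝ 2 μ) - v) ((w n : Lp ℝ 2 μ) - v)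
      have h4 := hanti hm1
      have h5 := hanti hn1
      have : ‖(1 / 2 : ℝ)‖ = 1 / 2 := by norm_num
      rw [this]
      linarith
    have h6 := hαle _ _ hmid
    have h7 := 𝓔.form_parallelogram (w m) (w n)
    have h8 := hwA m
    have h9 := hwA n
    have h10 : ‖((w m - w n : 𝓔.domain) : Lp ℝ 2 μ)‖ ≤ 1 / ((m : ℝ) + 1) + 1 / ((n : ℝ) + 1) := by
      have : ((w m - w n : 𝓔.domain) : Lp ℝ 2 μ)
          = ((w m : Lp ℝ 2 μ) - v) - ((w n : Lp ℝ 2 μ) - v) := by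
        push_cast
        abel
      rw [this]
      exact (norm_sub_le _ _).trans (add_le_add hmK hnK)
    have h11 := lt_min_iff.mp hm2
    have h12 := lt_min_iff.mp hn2
    have h13 : ‖((w m - w n : 𝓔.domain) : Lp ℝ 2 μ)‖ ^ 2 ≤ 2 * (ε / 24 + ε / 24) := by
      have h0 := norm_nonneg ((w m - w n : 𝓔.domain) : Lp ℝ 2 μ)
      have ha : ‖((w m - w n : 𝓔.domain) : Lp ℝ 2 μ)‖ ≤ 2 := by linarith [h11.2, h12.2]
      have hb : ‖((w m - w n : 𝓔.domain) : Lp ℝ 2 μ)‖ ≤ ε / 24 + ε / 24 := by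
        linarith [h11.1, h12.1]
      rw [sq]
      exact mul_le_mul ha hb h0 (by norm_num)
    linarith [h11.1, h12.1]
  obtain ⟨z, hz⟩ := 𝓔.closed w hcauchy
  have hzero : ‖(z : Lp ℝ 2 μ) - v‖ = 0 := by
    by_contra hne
    have hpos : 0 < ‖(z : Lp ℝ 2 μ) - v‖ := lt_of_le_of_ne (norm_nonneg _) (Ne.symm hne)
    set d := ‖(z : Lp ℝ 2 μ) - v‖ with hd
    obtain ⟨N₂, hN₂⟩ := hsmall (d / 2) (by positivity)
    have hev := (hz.eventually (gt_mem_nhds (show (0 : ℝ) < (d / 2) ^ 2 by positivity))).and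
      (eventually_ge_atTop N₂)
    obtain ⟨n, hn, hnN⟩ := hev.exists
    have h1 := hN₂ n hnN
    have h2 : ‖(w n : Lp ℝ 2 μ) - v‖ ≤ 1 / ((n : ℝ) + 1) := hwK n
    have h3 : ‖((w n - z : 𝓔.domain) : Lp ℝ 2 μ)‖ < d / 2 := by
      have := 𝓔.nonneg (w n - z)
      exact lt_of_pow_lt_pow_left₀ 2 (by positivity) (by linarith)
    have h4 : (z : Lp ℝ 2 μ) - v
        = ((w n : Lp ℝ 2 μ) - v) - ((w n - z : 𝓔.domain) : Lp ℝ 2 μ) := by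
      push_cast
      abel
    have h5 := norm_sub_le ((w n : Lp ℝ 2 μ) - v) ((w n - z : 𝓔.domain) : Lp ℝ 2 μ)
    rw [← h4] at h5
    linarith
  have : (z : Lp ℝ 2 μ) = v := sub_eq_zero.mp (norm_eq_zero.mp hzero)
  rw [← this]
  exact z.2

/-- The truncation `u ↦ min u c` operates on the form, for every `c > 0`. -/
theorem exists_min (u : 𝓔.domain) {c : ℝ} (hc : 0 < c) :
    ∃ v : 𝓔.domain, ((v : Lp ℝ 2 μ) =ᵐ[μ] fun x => min ((u : Lp ℝ 2 μ) x) c) ∧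
      𝓔.form v v ≤ 𝓔.form u u := by
  obtain ⟨v, hv, hE⟩ := 𝓔.markov (c⁻¹ • u)
  refine ⟨c • v, ?_, ?_⟩
  · have h1 : (((c⁻¹ • u : 𝓔.domain) : Lp ℝ 2 μ) : X → ℝ) =ᵐ[μ] c⁻¹ • ((u : Lp ℝ 2 μ) : X → ℝ) :=
      Lp.coeFn_smul _ _
    have h2 : (((c • v : 𝓔.domain) : Lp ℝ 2 μ) : X → ℝ) =ᵐ[μ] c • ((v : Lp ℝ 2 μ) : X → ℝ) :=
      Lp.coeFn_smul _ _
    filter_upwards [hv, h1, h2] with x hx h1x h2x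
    rw [h2x, Pi.smul_apply, hx, h1x, Pi.smul_apply, smul_eq_mul, smul_eq_mul,
      mul_min_of_nonneg _ _ hc.le, mul_inv_cancel_left₀ hc.ne', mul_one]
  · rw [form_smul]
    rw [form_smul] at hE
    calc c ^ 2 * 𝓔.form v v ≤ c ^ 2 * (c⁻¹ ^ 2 * 𝓔.form u u) := by gcongr
      _ = 𝓔.form u u := by field_simp

/-- Piecewise linear interpolation of the square function on `[-N h, N h]`. -/
def sqApprox (h : ℝ) (N : ℕ) (x : ℝ) : ℝ :=
  ∑ k ∈ Finset.range N, 2 * h *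
    ((x - min x (((k : ℝ) + 1) * h)) + (-x - min (-x) (((k : ℝ) + 1) * h)))

theorem abs_sq_sub_sqApprox_le {h : ℝ} (hh : 0 < h) (N : ℕ) (x : ℝ) (hx : |x| ≤ N * h) :
    |x ^ 2 - sqApprox h N x| ≤ 2 * h * |x| := by
  have key : ∀ M : ℕ, ∀ s : ℝ, 0 ≤ s → M * h ≤ s →
      ∑ k ∈ Finset.range M, 2 * h * (s - min s (((k : ℝ) + 1) * h))
        = 2 * h * M * s - h ^ 2 * M * (M + 1) := by
    intro M s hs
    induction M with
    | zero => intro _; simp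
    | succ M ih =>
      intro hM
      push_cast at hM ⊢
      rw [Finset.sum_range_succ, ih (by nlinarith), min_eq_right hM]
      ring
  have main : ∀ M : ℕ, ∀ s : ℝ, 0 ≤ s → s ≤ M * h →
      |s ^ 2 - ∑ k ∈ Finset.range M, 2 * h * (s - min s (((k : ℝ) + 1) * h))| ≤ 2 * h * s := by
    intro M s hs
    induction M with
    | zero =>
      intro hM
      have : s = 0 := le_antisymm (by simpa using hM) hs
      simp [this]
    | succ M ih =>
      intro hM
      push_cast at hM
      rw [Finset.sum_range_succ, min_eq_left hM, sub_self, mul_zero, add_zero]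
      rcases le_total s (M * h) with h1 | h1
      · exact ih h1
      · rw [key M s hs h1, abs_le]
        have hMh : 0 ≤ M * h := by positivity
        constructor
        · nlinarith [sq_nonneg (s - M * h), mul_nonneg hMh hh.le, mul_nonneg hh.le hs]
        · nlinarith [mul_nonneg (sub_nonneg.mpr h1) (sub_nonneg.mpr hM),
            mul_le_mul_of_nonneg_right h1 hh.le]
  have hred : sqApprox h N x
      = ∑ k ∈ Finset.range N, 2 * h * (|x| - min |x| (((k : ℝ) + 1) * h)) := by
    unfold sqApprox
    refine Finset.sum_congr rfl fun k _ => ?_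
    have hk : 0 < ((k : ℝ) + 1) * h := by positivity
    rcases le_total 0 x with h0 | h0
    · rw [abs_of_nonneg h0, min_eq_left (by linarith : -x ≤ ((k : ℝ) + 1) * h)]
      ring
    · rw [abs_of_nonpos h0, min_eq_left (by linarith : x ≤ ((k : ℝ) + 1) * h)]
      ring
  rw [hred, ← sq_abs x]
  exact main N |x| (abs_nonneg x) hx

theorem exists_sqApprox (u : 𝓔.domain) {h : ℝ} (hh : 0 < h) (N : ℕ) :
    ∃ v : 𝓔.domain, ((v : Lp ℝ 2 μ) =ᵐ[μ] fun x => sqApprox h N ((u : Lp ℝ 2 μ) x)) ∧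
      𝓔.form v v ≤ (8 * (N * h) * √(𝓔.form u u)) ^ 2 := by
  set s := √(𝓔.form u u) with hs
  have hs0 : 0 ≤ s := Real.sqrt_nonneg _
  have hsu : 𝓔.form u u ≤ s ^ 2 := by rw [hs, Real.sq_sqrt (𝓔.nonneg u)]
  induction N with
  | zero =>
    refine ⟨0, ?_, by simp⟩
    have h0 : (((0 : 𝓔.domain) : Lp ℝ 2 μ) : X → ℝ) =ᵐ[μ] 0 := Lp.coeFn_zero _ _ _
    filter_upwards [h0] with x hx
    simpa [sqApprox] using hx
  | succ N ih =>
    obtain ⟨v, hv, hvE⟩ := ih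
    have hc : 0 < ((N : ℝ) + 1) * h := by positivity
    obtain ⟨a, ha, haE⟩ := 𝓔.exists_min u hc
    obtain ⟨b, hb, hbE⟩ := 𝓔.exists_min (-u) hc
    rw [form_neg] at hbE
    refine ⟨v + (2 * h) • ((u + -a) + (-u + -b)), ?_, ?_⟩
    · have e1 : (((v + (2 * h) • ((u + -a) + (-u + -b)) : 𝓔.domain) : Lp ℝ 2 μ) : X → ℝ)
          =ᵐ[μ] fun x => (v : Lp ℝ 2 μ) x + 2 * h * (((u : Lp ℝ 2 μ) x - (a : Lp ℝ 2 μ) x)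
            + (-(u : Lp ℝ 2 μ) x - (b : Lp ℝ 2 μ) x)) := by
        push_cast
        refine (Lp.coeFn_add _ _).trans ?_
        filter_upwards [Lp.coeFn_smul (2 * h)
            (((u : Lp ℝ 2 μ) + -(a : Lp ℝ 2 μ)) + (-(u : Lp ℝ 2 μ) + -(b : Lp ℝ 2 μ))),
          Lp.coeFn_add ((u : Lp ℝ 2 μ) + -(a : Lp ℝ 2 μ)) (-(u : Lp ℝ 2 μ) + -(b : Lp ℝ 2 μ)),
          Lp.coeFn_add (u : Lp ℝ 2 μ) (-(a : Lp ℝ 2 μ)),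
          Lp.coeFn_add (-(u : Lp ℝ 2 μ)) (-(b : Lp ℝ 2 μ)),
          Lp.coeFn_neg (u : Lp ℝ 2 μ), Lp.coeFn_neg (a : Lp ℝ 2 μ),
          Lp.coeFn_neg (b : Lp ℝ 2 μ)] with x h1 h2 h3 h4 h5 h6 h7
        simp only [Pi.add_apply, Pi.smul_apply, Pi.neg_apply, smul_eq_mul] at *
        rw [h1, h2, h3, h4, h5, h6, h7]
        ring
      have e2 : (((-u : 𝓔.domain) : Lp ℝ 2 μ) : X → ℝ) =ᵐ[μ] -((u : Lp ℝ 2 μ) : X → ℝ) :=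
        Lp.coeFn_neg _
      filter_upwards [e1, e2, hv, ha, hb] with x h1 h2 h3 h4 h5
      rw [h1, h3, h4, h5, h2]
      simp only [sqApprox, Finset.sum_range_succ, Pi.neg_apply]
    · have f1 : 𝓔.form (u + -a) (u + -a) ≤ (s + s) ^ 2 :=
        𝓔.form_add_le hs0 hs0 hsu (by rw [form_neg]; linarith)
      have f2 : 𝓔.form (-u + -b) (-u + -b) ≤ (s + s) ^ 2 :=
        𝓔.form_add_le hs0 hs0 (by rw [form_neg]; exact hsu) (by rw [form_neg]; linarith)
      have f3 := 𝓔.form_add_le (by positivity) (by positivity) f1 f2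
      have f4 : 𝓔.form ((2 * h) • ((u + -a) + (-u + -b))) ((2 * h) • ((u + -a) + (-u + -b)))
          ≤ (8 * h * s) ^ 2 := by
        rw [form_smul]
        calc (2 * h) ^ 2 * _ ≤ (2 * h) ^ 2 * (s + s + (s + s)) ^ 2 := by gcongr
          _ = (8 * h * s) ^ 2 := by ring
      refine (𝓔.form_add_le (by positivity) (by positivity) hvE f4).trans (le_of_eq ?_)
      push_cast
      ring

/-- The square of a bounded element of the domain belongs to the domain. -/
theorem exists_sq (u : 𝓔.domain) {M : ℝ} (hM : ∀ᵐ x ∂μ, |(u : Lp ℝ 2 μ) x| ≤ M) :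
    ∃ v : 𝓔.domain, (v : Lp ℝ 2 μ) =ᵐ[μ] fun x => (u : Lp ℝ 2 μ) x ^ 2 := by
  wlog hM0 : 0 < M generalizing M
  · refine this (M := max M 1) ?_ (by positivity)
    filter_upwards [hM] with x hx using hx.trans (le_max_left _ _)
  have hmem : MemLp (fun x => (u : Lp ℝ 2 μ) x ^ 2) 2 μ := by
    refine MemLp.of_le_mul (c := M) (Lp.memLp (u : Lp ℝ 2 μ)) ?_ ?_
    · exact (Lp.aestronglyMeasurable _).pow 2
    · filter_upwards [hM] with x hx
      rw [norm_pow, sq, Real.norm_eq_abs]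
      gcongr
  refine ⟨⟨hmem.toLp _, ?_⟩, hmem.coeFn_toLp⟩
  refine 𝓔.mem_domain_of_approx _ ((8 * M * √(𝓔.form u u)) ^ 2) fun δ hδ => ?_
  obtain ⟨N, hN⟩ := exists_nat_gt (2 * M * ‖(u : Lp ℝ 2 μ)‖ / δ)
  have hpos : (0 : ℝ) < (N : ℝ) + 1 := by positivity
  have hh : 0 < M / ((N : ℝ) + 1) := by positivity
  have hNM : ((N + 1 : ℕ) : ℝ) * (M / ((N : ℝ) + 1)) = M := by
    push_cast
    field_simp
  obtain ⟨w, hw, hwE⟩ := 𝓔.exists_sqApprox u hh (N + 1)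
  rw [hNM] at hwE
  refine ⟨w, hwE, ?_⟩
  refine (Lp.norm_le_mul_norm_of_ae_le_mul (c := 2 * (M / ((N : ℝ) + 1)))
    (g := (u : Lp ℝ 2 μ)) ?_).trans ?_
  · filter_upwards [Lp.coeFn_sub (w : Lp ℝ 2 μ) (hmem.toLp _), hw, hmem.coeFn_toLp, hM]
      with x h1 h2 h3 h4
    rw [h1, Pi.sub_apply, h2, h3, Real.norm_eq_abs, Real.norm_eq_abs, abs_sub_comm]
    exact abs_sq_sub_sqApprox_le hh (N + 1) _ (by rw [hNM]; exact h4)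
  · rw [div_lt_iff₀ hδ] at hN
    rw [mul_div_assoc', div_mul_eq_mul_div, div_le_iff₀ hpos]
    nlinarith

/-! ### The multiplicative lattice of bounded integrable functions of finite energy -/

/-- The equivalence class of the function `f` belongs to the domain of the form. -/
def HasEnergy (f : X → ℝ) : Prop := ∃ u : 𝓔.domain, (u : Lp ℝ 2 μ) =ᵐ[μ] f

theorem HasEnergy.add {f g : X → ℝ} (hf : 𝓔.HasEnergy f) (hg : 𝓔.HasEnergy g) :
    𝓔.HasEnergy (f + g) := by
  obtain ⟨u, hu⟩ := hf
  obtain ⟨v, hv⟩ := hg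
  exact ⟨u + v, (Lp.coeFn_add _ _).trans (hu.add hv)⟩

theorem HasEnergy.smul (c : ℝ) {f : X → ℝ} (hf : 𝓔.HasEnergy f) : 𝓔.HasEnergy (c • f) := by
  obtain ⟨u, hu⟩ := hf
  exact ⟨c • u, (Lp.coeFn_smul _ _).trans (hu.const_smul c)⟩

theorem HasEnergy.sq {f : X → ℝ} (hf : 𝓔.HasEnergy f) {C : ℝ} (hC : ∀ x, |f x| ≤ C) :
    𝓔.HasEnergy (fun x => f x ^ 2) := by
  obtain ⟨u, hu⟩ := hf
  obtain ⟨v, hv⟩ := 𝓔.exists_sq u (M := C) (by filter_upwards [hu] with x hx; rw [hx]; exact hC x)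
  refine ⟨v, ?_⟩
  filter_upwards [hu, hv] with x h1 h2
  rw [h2, h1]

theorem HasEnergy.mul {f g : X → ℝ} (hf : 𝓔.HasEnergy f) (hg : 𝓔.HasEnergy g) {C D : ℝ}
    (hC : ∀ x, |f x| ≤ C) (hD : ∀ x, |g x| ≤ D) : 𝓔.HasEnergy (f * g) := by
  have h1 := HasEnergy.sq 𝓔 (hf.add 𝓔 hg) (C := C + D)
    (fun x => (abs_add_le _ _).trans (add_le_add (hC x) (hD x)))
  have h2 := HasEnergy.sq 𝓔 hf hC
  have h3 := HasEnergy.sq 𝓔 hg hD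
  have h4 := HasEnergy.smul 𝓔 (1 / 2)
    (HasEnergy.add 𝓔 h1 (HasEnergy.smul 𝓔 (-1) (HasEnergy.add 𝓔 h2 h3)))
  convert h4 using 1
  ext x
  simp only [Pi.mul_apply, Pi.smul_apply, Pi.add_apply, smul_eq_mul]
  ring

/-- `𝓑(𝓔)`: the bounded measurable functions (not classes) on `X` whose `μ`-class lies in
`domain ∩ L¹(μ)`; an algebra under the pointwise operations. -/
def boundedDomain : NonUnitalSubalgebra ℝ (X → ℝ) where
  carrier := {f | Measurable f ∧ (∃ C, ∀ x, |f x| ≤ C) ∧ Integrable f μ ∧ 𝓔.HasEnergy f}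
  zero_mem' := ⟨measurable_const, ⟨0, by simp⟩, integrable_zero _ _ _, 0, Lp.coeFn_zero _ _ _⟩
  add_mem' := by
    rintro f g ⟨hf, ⟨C, hC⟩, hfi, hfE⟩ ⟨hg, ⟨D, hD⟩, hgi, hgE⟩
    exact ⟨hf.add hg, ⟨C + D, fun x => (abs_add_le _ _).trans (add_le_add (hC x) (hD x))⟩,
      hfi.add hgi, hfE.add 𝓔 hgE⟩
  smul_mem' := by
    rintro c f ⟨hf, ⟨C, hC⟩, hfi, hfE⟩
    refine ⟨hf.const_smul c, ⟨|c| * C, fun x => ?_⟩, hfi.smul c, hfE.smul 𝓔 c⟩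
    rw [Pi.smul_apply, smul_eq_mul, abs_mul]
    gcongr
    exact hC x
  mul_mem' := by
    rintro f g ⟨hf, ⟨C, hC⟩, hfi, hfE⟩ ⟨hg, ⟨D, hD⟩, hgi, hgE⟩
    refine ⟨hf.mul hg, ⟨C * D, fun x => ?_⟩, ?_, hfE.mul 𝓔 hgE hC hD⟩
    · rw [Pi.mul_apply, abs_mul]
      exact mul_le_mul (hC x) (hD x) (abs_nonneg _) ((abs_nonneg _).trans (hC x))
    · exact hgi.bdd_mul hf.aestronglyMeasurable (Eventually.of_forall fun x => hC x)

variable {𝓔}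

theorem measurable_coe (f : 𝓔.boundedDomain) : Measurable (f : X → ℝ) := f.2.1

theorem exists_bound (f : 𝓔.boundedDomain) : ∃ C, ∀ x, |(f : X → ℝ) x| ≤ C := f.2.2.1

theorem integrable_coe (f : 𝓔.boundedDomain) : Integrable (f : X → ℝ) μ := f.2.2.2.1

theorem hasEnergy_coe (f : 𝓔.boundedDomain) : 𝓔.HasEnergy (f : X → ℝ) := f.2.2.2.2

/-- The `μ`-equivalence class of `f ∈ 𝓑(𝓔)`, as an element of the domain of the form. -/
noncomputable def toDomain (f : 𝓔.boundedDomain) : 𝓔.domain := (hasEnergy_coe f).choose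

theorem coeFn_toDomain (f : 𝓔.boundedDomain) :
    (toDomain f : Lp ℝ 2 μ) =ᵐ[μ] (f : X → ℝ) := (hasEnergy_coe f).choose_spec

/-- `𝓔(f, g)` for `f, g ∈ 𝓑(𝓔)`. -/
noncomputable def energy (f g : 𝓔.boundedDomain) : ℝ := 𝓔.form (toDomain f) (toDomain g)

/-! ### Characters of a C⋆-algebra without unit -/

theorem character_mem_quasispectrum {A : Type*} [NonUnitalCStarAlgebra A]
    (χ : WeakDual.characterSpace ℂ A) (a : A) : χ a ∈ quasispectrum ℂ a := by
  refine NonUnitalAlgHom.quasispectrum_apply_subset χ a ?_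
  by_cases h : χ a = 0
  · rw [h]
    exact quasispectrum.zero_mem ℂ _
  · rw [quasispectrum_eq_spectrum_union_zero]
    left
    rw [spectrum.mem_iff]
    simp

theorem character_im_of_isSelfAdjoint {A : Type*} [NonUnitalCStarAlgebra A]
    (χ : WeakDual.characterSpace ℂ A) {a : A} (ha : IsSelfAdjoint a) : (χ a).im = 0 := by
  have h3 := ha.quasispectrumRestricts.rightInvOn (character_mem_quasispectrum χ a)
  rw [← h3]
  simp

theorem norm_character_le {A : Type*} [NonUnitalCStarAlgebra A]
    (χ : WeakDual.characterSpace ℂ A) (a : A) : ‖χ a‖ ≤ ‖a‖ := by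
  have h2 := character_mem_quasispectrum χ a
  rw [Unitization.quasispectrum_eq_spectrum_inr' ℂ ℂ,
    ← AlgEquiv.spectrum_eq (WithLp.unitizationAlgEquiv ℂ).symm (a : Unitization ℂ A)] at h2
  have h3 := spectrum.norm_le_norm_mul_of_mem h2
  have h4 : ‖(WithLp.unitizationAlgEquiv (𝕜 := ℂ) (A := A) ℂ).symm
      (a : Unitization ℂ A)‖ = ‖a‖ := WithLp.unitization_norm_inr a
  have h5 : ‖(1 : WithLp 1 (Unitization ℂ A))‖ = 1 := by
    rw [WithLp.unitization_norm_def]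
    change ‖(1 : ℂ)‖ + ‖(0 : A)‖ = 1
    simp
  rw [h4, h5, mul_one] at h3
  exact h3

theorem isCompact_character_ge {A : Type*} [NonUnitalCStarAlgebra A] (a : A) {ε : ℝ}
    (hε : 0 < ε) : IsCompact {χ : WeakDual.characterSpace ℂ A | ε ≤ |(χ a).re|} := by
  rw [Topology.IsEmbedding.subtypeVal.isCompact_iff]
  have himg : (Subtype.val '' {χ : WeakDual.characterSpace ℂ A | ε ≤ |(χ a).re|} :
        Set (WeakDual ℂ A))
      = ({φ | ∀ x y : A, φ (x * y) = φ x * φ y} ∩ {φ | ∀ x, ‖φ x‖ ≤ ‖x‖})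
        ∩ {φ | ε ≤ |(φ a).re|} := by
    ext φ
    constructor
    · rintro ⟨χ, hχ, rfl⟩
      exact ⟨⟨χ.2.2, norm_character_le χ⟩, hχ⟩
    · rintro ⟨⟨h1, -⟩, h3⟩
      have h3' : ε ≤ |(φ a).re| := h3
      refine ⟨⟨φ, ?_, h1⟩, h3, rfl⟩
      rintro rfl
      have : ((0 : WeakDual ℂ A) a) = 0 := rfl
      rw [this] at h3'
      simp at h3'
      linarith
  rw [himg]
  refine WeakDual.isCompact_of_bounded_of_closed (𝕜 := ℂ) ?_ ?_
  · refine (Metric.isBounded_closedBall (x := (0 : StrongDual ℂ A)) (r := 1)).subset ?_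
    rintro φ ⟨⟨-, h⟩, -⟩
    rw [mem_closedBall_zero_iff]
    exact ContinuousLinearMap.opNorm_le_bound _ zero_le_one fun x => by
      rw [one_mul]; exact h x
  · refine (IsClosed.inter ?_ ?_).inter ?_
    · simp only [Set.ofPred_forall]
      exact isClosed_iInter fun x => isClosed_iInter fun y =>
        isClosed_eq (WeakDual.eval_continuous _)
          ((WeakDual.eval_continuous _).mul (WeakDual.eval_continuous _))
    · simp only [Set.ofPred_forall]
      exact isClosed_iInter fun x =>
        isClosed_le (WeakDual.eval_continuous _).norm continuous_const
    · exact isClosed_le continuous_const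
        (Complex.continuous_re.comp (WeakDual.eval_continuous a)).abs

/-! ### The C⋆-algebra generated by `𝓑(𝓔)` and its spectrum -/

theorem memℓp_ofReal (f : 𝓔.boundedDomain) :
    Memℓp (fun x => ((f : X → ℝ) x : ℂ)) ∞ := by
  obtain ⟨C, hC⟩ := exists_bound f
  refine memℓp_infty ⟨C, ?_⟩
  rintro _ ⟨x, rfl⟩
  simpa using hC x

/-- A function in `𝓑(𝓔)`, as an element of the C⋆-algebra `ℓ^∞(X, ℂ)` of all bounded complex
functions on `X` with the supremum norm. -/
noncomputable def toBounded (f : 𝓔.boundedDomain) : lp (fun _ : X => ℂ) ∞ := ⟨_, memℓp_ofReal f⟩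

@[simp] theorem toBounded_apply (f : 𝓔.boundedDomain) (x : X) :
    toBounded f x = ((f : X → ℝ) x : ℂ) := rfl

theorem toBounded_add (f g : 𝓔.boundedDomain) :
    toBounded (f + g) = toBounded f + toBounded g := by
  ext x; simp

theorem toBounded_smul (c : ℝ) (f : 𝓔.boundedDomain) :
    toBounded (c • f) = (c : ℂ) • toBounded f := by
  ext x
  change ((c * (f : X → ℝ) x : ℝ) : ℂ) = c * ((f : X → ℝ) x : ℂ)
  push_cast
  ring

theorem toBounded_mul (f g : 𝓔.boundedDomain) :
    toBounded (f * g) = toBounded f * toBounded g := by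
  ext x; simp

variable (𝓔)

/-- The complexification `𝓑(𝓔) + i 𝓑(𝓔)`. -/
noncomputable def complexification : NonUnitalStarSubalgebra ℂ (lp (fun _ : X => ℂ) ∞) where
  carrier := {F | ∃ f g : 𝓔.boundedDomain, F = toBounded f + Complex.I • toBounded g}
  zero_mem' := ⟨0, 0, by
    ext x
    change (0 : ℂ) = ((0 : ℝ) : ℂ) + Complex.I * ((0 : ℝ) : ℂ)
    simp⟩
  add_mem' := by
    rintro _ _ ⟨f, g, rfl⟩ ⟨f', g', rfl⟩
    refine ⟨f + f', g + g', ?_⟩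
    rw [toBounded_add, toBounded_add, smul_add]
    abel
  smul_mem' := by
    rintro c _ ⟨f, g, rfl⟩
    refine ⟨c.re • f + (-c.im) • g, c.re • g + c.im • f, ?_⟩
    simp only [toBounded_add, toBounded_smul]
    ext x
    change c * (((f : X → ℝ) x : ℂ) + Complex.I * ((g : X → ℝ) x : ℂ)) =
      ((c.re : ℂ) * ((f : X → ℝ) x : ℂ) + ((-c.im : ℝ) : ℂ) * ((g : X → ℝ) x : ℂ))
      + Complex.I * ((c.re : ℂ) * ((g : X → ℝ) x : ℂ) + (c.im : ℂ) * ((f : X → ℝ) x : ℂ))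
    apply Complex.ext
    · simp; ring
    · simp
  mul_mem' := by
    rintro _ _ ⟨f, g, rfl⟩ ⟨f', g', rfl⟩
    refine ⟨f * f' + (-1 : ℝ) • (g * g'), f * g' + g * f', ?_⟩
    simp only [toBounded_add, toBounded_smul, toBounded_mul]
    ext x
    change (((f : X → ℝ) x : ℂ) + Complex.I * ((g : X → ℝ) x : ℂ))
        * (((f' : X → ℝ) x : ℂ) + Complex.I * ((g' : X → ℝ) x : ℂ)) =
      (((f : X → ℝ) x : ℂ) * ((f' : X → ℝ) x : ℂ)
        + ((-1 : ℝ) : ℂ) * (((g : X → ℝ) x : ℂ) * ((g' : X → ℝ) x : ℂ)))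
      + Complex.I * (((f : X → ℝ) x : ℂ) * ((g' : X → ℝ) x : ℂ)
        + ((g : X → ℝ) x : ℂ) * ((f' : X → ℝ) x : ℂ))
    apply Complex.ext
    · simp; ring
    · simp
  star_mem' := by
    rintro _ ⟨f, g, rfl⟩
    refine ⟨f, (-1 : ℝ) • g, ?_⟩
    simp only [toBounded_smul]
    ext x
    change star (((f : X → ℝ) x : ℂ) + Complex.I * ((g : X → ℝ) x : ℂ)) =
      ((f : X → ℝ) x : ℂ) + Complex.I * (((-1 : ℝ) : ℂ) * ((g : X → ℝ) x : ℂ))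
    apply Complex.ext <;> simp

/-- `A(𝓑(𝓔))`: the uniform closure of the complexification of `𝓑(𝓔)`. -/
noncomputable def algebra : NonUnitalStarSubalgebra ℂ (lp (fun _ : X => ℂ) ∞) :=
  𝓔.complexification.topologicalClosure

instance isClosed_algebra : IsClosed (𝓔.algebra : Set (lp (fun _ : X => ℂ) ∞)) :=
  𝓔.complexification.isClosed_topologicalClosure

/-- The C⋆-algebra `A(𝓑(𝓔))`, as a type. -/
def Alg : Type _ := 𝓔.algebra

noncomputable instance : NonUnitalCommCStarAlgebra 𝓔.Alg :=
  NonUnitalStarSubalgebra.nonUnitalCommCStarAlgebra 𝓔.algebra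

/-- `Δ`: the spectrum of `A(𝓑(𝓔))`, that is the space of its nonzero continuous multiplicative
linear functionals with the topology of pointwise convergence. -/
abbrev Spectrum : Type _ := WeakDual.characterSpace ℂ 𝓔.Alg

noncomputable instance : MeasurableSpace 𝓔.Spectrum := borel _

instance : BorelSpace 𝓔.Spectrum := ⟨rfl⟩

/-- `𝓑(𝓔)` vanishes nowhere on `X`. -/
def VanishesNowhere : Prop := ∀ x : X, ∃ f : 𝓔.boundedDomain, (f : X → ℝ) x ≠ 0

/-- `𝓑(𝓔)` is separable for the supremum norm. -/
def SupSeparable : Prop :=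
  TopologicalSpace.IsSeparable (Set.range (toBounded : 𝓔.boundedDomain → lp (fun _ : X => ℂ) ∞))

variable {𝓔}

/-- The inclusion of `𝓑(𝓔)` into `A(𝓑(𝓔))`. -/
noncomputable def toAlgebra (f : 𝓔.boundedDomain) : 𝓔.Alg :=
  ⟨toBounded f, NonUnitalStarSubalgebra.le_topologicalClosure _ ⟨f, 0, by
    ext x
    change ((f : X → ℝ) x : ℂ) = ((f : X → ℝ) x : ℂ) + Complex.I * ((0 : ℝ) : ℂ)
    simp⟩⟩

theorem isSelfAdjoint_toAlgebra (f : 𝓔.boundedDomain) : IsSelfAdjoint (toAlgebra f) := by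
  apply Subtype.ext
  ext x
  change star ((f : X → ℝ) x : ℂ) = ((f : X → ℝ) x : ℂ)
  simp

/-- Characters take real values on `𝓑(𝓔)`. -/
theorem character_im (f : 𝓔.boundedDomain) (χ : 𝓔.Spectrum) : (χ (toAlgebra f)).im = 0 :=
  character_im_of_isSelfAdjoint χ (isSelfAdjoint_toAlgebra f)

theorem toAlgebra_add (f g : 𝓔.boundedDomain) :
    toAlgebra (f + g) = toAlgebra f + toAlgebra g := Subtype.ext (toBounded_add f g)

theorem toAlgebra_smul (c : ℝ) (f : 𝓔.boundedDomain) :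
    toAlgebra (c • f) = (c : ℂ) • toAlgebra f := Subtype.ext (toBounded_smul c f)

theorem toAlgebra_mul (f g : 𝓔.boundedDomain) :
    toAlgebra (f * g) = toAlgebra f * toAlgebra g := Subtype.ext (toBounded_mul f g)

variable (𝓔)

/-- The Gelfand transform `f ↦ f̂`, `f̂(χ) = χ(f)`, restricted to `𝓑(𝓔)`, with values in
`C₀(Δ, ℝ)`; taking the real part only changes the codomain, since `χ(f)` is real. -/
noncomputable def gelfand : 𝓔.boundedDomain →ₙₐ[ℝ] C₀(𝓔.Spectrum, ℝ) where
  toFun f :=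
    { toFun := fun χ => (χ (toAlgebra f)).re
      continuous_toFun := Complex.continuous_re.comp
        ((WeakDual.eval_continuous (toAlgebra f)).comp continuous_subtype_val)
      zero_at_infty' := by
        rw [Metric.tendsto_nhds]
        intro ε hε
        refine mem_cocompact.mpr ⟨_, isCompact_character_ge (toAlgebra f) hε, fun χ hχ => ?_⟩
        simpa using hχ }
  map_smul' c f := by
    ext χ
    change (χ (toAlgebra (c • f))).re = c * (χ (toAlgebra f)).re
    rw [toAlgebra_smul, map_smul]
    simp
  map_zero' := by
    ext χ
    change (χ (toAlgebra (0 : 𝓔.boundedDomain))).re = 0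
    rw [← zero_smul ℝ (0 : 𝓔.boundedDomain), toAlgebra_smul, map_smul]
    simp
  map_add' f g := by
    ext χ
    change (χ (toAlgebra (f + g))).re = (χ (toAlgebra f)).re + (χ (toAlgebra g)).re
    rw [toAlgebra_add, map_add, Complex.add_re]
  map_mul' f g := by
    ext χ
    change (χ (toAlgebra (f * g))).re = (χ (toAlgebra f)).re * (χ (toAlgebra g)).re
    rw [toAlgebra_mul, map_mul, Complex.mul_re, character_im f, zero_mul, sub_zero]

variable {𝓔}

theorem ofReal_gelfand_apply (f : 𝓔.boundedDomain) (χ : 𝓔.Spectrum) :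
    ((𝓔.gelfand f χ : ℝ) : ℂ) = χ (toAlgebra f) :=
  Complex.ext rfl (character_im f χ).symm

variable (𝓔)

theorem gelfand_injective : Function.Injective 𝓔.gelfand := by
  intro f g hfg
  apply Subtype.ext
  funext x
  by_contra hne
  let ev : 𝓔.Alg →ₗ[ℂ] ℂ :=
    { toFun := fun a => a.1 x
      map_add' := fun _ _ => rfl
      map_smul' := fun _ _ => rfl }
  let φ : WeakDual ℂ 𝓔.Alg := (ev.mkContinuous 1 fun a => by
    rw [one_mul]
    exact lp.norm_apply_le_norm ENNReal.top_ne_zero a.1 x :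
      StrongDual ℂ 𝓔.Alg)
  have hφ : ∀ h : 𝓔.boundedDomain, φ (toAlgebra h) = ((h : X → ℝ) x : ℂ) := fun _ => rfl
  have hφ0 : φ ≠ 0 := by
    intro h0
    have h1 := hφ f
    have h2 := hφ g
    rw [h0] at h1 h2
    exact hne (by exact_mod_cast h1.symm.trans h2)
  let χ : 𝓔.Spectrum := ⟨φ, hφ0, fun _ _ => rfl⟩
  have h3 := congrArg (fun F => F χ) hfg
  exact hne h3

/-- `𝓑̂(𝓔)`: the image of `𝓑(𝓔)` under the Gelfand transform. -/
noncomputable def hatDomain : NonUnitalSubalgebra ℝ C₀(𝓔.Spectrum, ℝ) :=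
  NonUnitalAlgHom.range 𝓔.gelfand

variable {𝓔}

/-- The unique `f ∈ 𝓑(𝓔)` whose Gelfand transform is the given element of `𝓑̂(𝓔)`. -/
noncomputable def preimage (u : 𝓔.hatDomain) : 𝓔.boundedDomain := u.2.choose

theorem gelfand_preimage (u : 𝓔.hatDomain) : 𝓔.gelfand (preimage u) = u := u.2.choose_spec

/-- The Gelfand transform as a map onto `𝓑̂(𝓔)`. -/
noncomputable def hat (f : 𝓔.boundedDomain) : 𝓔.hatDomain := ⟨𝓔.gelfand f, f, rfl⟩

/-- The transferred form on `𝓑̂(𝓔)`, determined by `𝓔̂(f̂, ĝ) = 𝓔(f, g)`. -/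
noncomputable def hatEnergy (u v : 𝓔.hatDomain) : ℝ := energy (preimage u) (preimage v)

theorem hatEnergy_hat (f g : 𝓔.boundedDomain) : hatEnergy (hat f) (hat g) = energy f g := by
  have h : ∀ f : 𝓔.boundedDomain, preimage (hat f) = f :=
    fun f => 𝓔.gelfand_injective (gelfand_preimage (hat f))
  rw [hatEnergy, h, h]

variable (𝓔)

/-- The form admits energy measures on `X` itself: for every `f ∈ 𝓑(𝓔)` there is a nonnegative
measure `Γ` on `X` with `2 ∫ φ dΓ = 2 𝓔(φ f, f) - 𝓔(φ, f²)` for all `φ ∈ 𝓑(𝓔)`. -/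
def AdmitsEnergyMeasures : Prop :=
  ∀ f : 𝓔.boundedDomain, ∃ Γ : Measure X, ∀ φ : 𝓔.boundedDomain,
    Integrable (φ : X → ℝ) Γ ∧
      2 * ∫ x, (φ : X → ℝ) x ∂Γ = 2 * energy (φ * f) f - energy φ (f * f)

end DirichletForm

/-! Write `R` for the normalized resolvent `β G_β`, with `β = n + 1`. The bounded forms `𝓔_β(u, v) =
β ⟪u - R u, v⟫ = 𝓔(R u, v)` converge to `𝓔` on the domain (`tendsto_form_resolvent`), and for them
the energy measure is explicit: `2 𝓔_β(φ f, f) - 𝓔_β(φ, f²) = β ∫ φ (R(f²) - 2 f R f + f²) dμ`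
(`approx_energy_eq`). The bracket is nonnegative because `R` is sub-Markovian, and `β` times its
integral is at most `2 𝓔(f, f)` because `R` contracts `L¹`. In the limit, `φ ↦ 𝓔(φ f, f) - 𝓔(φ, f²)
/ 2` is nonnegative for `φ ≥ 0` and bounded by `sup |φ| · 𝓔(f, f)`.

Such a functional need not be countably additive on `X`, but on the Gelfand side this causes no
loss. By Stone–Weierstrass the Gelfand transforms are dense in `C₀(Δ, ℝ)`, so the functional extends
continuously, stays positive, and is a finite Radon measure by Riesz–Markov–Kakutani; density also
gives uniqueness (`existsUnique_measure_of_dense`).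

For the counterexample, take the sequences `a + g` on `ℕ` with `g ∈ ℓ²` and the form `a a' + ⟪g,
g'⟫`. The energy measure of the constant `1` would have to integrate `φ` to half its limit. It is a
point mass at infinity, a point of `Δ` that is missing from `ℕ`. -/

namespace DirichletForm

/-! ### The resolvent: approximation of the form and sub-Markov property -/

section Resolvent

variable {X : Type*} [MeasurableSpace X] {μ : Measure X} (𝓔 : DirichletForm μ)

/-- The domain of the form, to be equipped with the inner product `𝓔(u, v) + (n + 1) ⟪u, v⟫`. -/
def EnergySpace (_n : ℕ) : Type _ := 𝓔.domain

noncomputable instance (n : ℕ) : AddCommGroup (𝓔.EnergySpace n) :=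
  inferInstanceAs (AddCommGroup 𝓔.domain)

noncomputable instance (n : ℕ) : Module ℝ (𝓔.EnergySpace n) :=
  inferInstanceAs (Module ℝ 𝓔.domain)

/-- The identity map from the energy space to the domain. -/
noncomputable def ofEnergySpace (n : ℕ) : 𝓔.EnergySpace n ≃ₗ[ℝ] 𝓔.domain :=
  LinearEquiv.refl ℝ 𝓔.domain

/-- The inner product `𝓔(u, v) + (n + 1) ⟪u, v⟫` on the domain. -/
@[reducible]
noncomputable def energyCore (n : ℕ) : InnerProductSpace.Core ℝ (𝓔.EnergySpace n) where
  inner u v := 𝓔.form (𝓔.ofEnergySpace n u) (𝓔.ofEnergySpace n v) +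
    (n + 1) * inner ℝ (𝓔.ofEnergySpace n u : Lp ℝ 2 μ) (𝓔.ofEnergySpace n v : Lp ℝ 2 μ)
  conj_inner_symm u v := by
    simp only [conj_trivial]
    rw [𝓔.symm, real_inner_comm]
  re_inner_nonneg u := by
    have h1 := 𝓔.nonneg (𝓔.ofEnergySpace n u)
    have h2 : 0 ≤ inner ℝ (𝓔.ofEnergySpace n u : Lp ℝ 2 μ) (𝓔.ofEnergySpace n u : Lp ℝ 2 μ) :=
      real_inner_self_nonneg
    simp only [RCLike.re_to_real]
    positivity
  add_left u v w := by
    simp only [map_add, LinearMap.add_apply, Submodule.coe_add, inner_add_left]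
    ring
  smul_left u v c := by
    simp only [map_smul, LinearMap.smul_apply, Submodule.coe_smul, real_inner_smul_left,
      smul_eq_mul, conj_trivial]
    ring
  definite u h := by
    have h1 := 𝓔.nonneg (𝓔.ofEnergySpace n u)
    have h2 : 0 ≤ inner ℝ (𝓔.ofEnergySpace n u : Lp ℝ 2 μ) (𝓔.ofEnergySpace n u : Lp ℝ 2 μ) :=
      real_inner_self_nonneg
    have h3 : inner ℝ (𝓔.ofEnergySpace n u : Lp ℝ 2 μ) (𝓔.ofEnergySpace n u : Lp ℝ 2 μ) = 0 := by
      have hn : (0 : ℝ) < n + 1 := by positivity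
      nlinarith
    exact Subtype.ext (inner_self_eq_zero.mp h3)

noncomputable instance (n : ℕ) : NormedAddCommGroup (𝓔.EnergySpace n) :=
  (𝓔.energyCore n).toNormedAddCommGroup

noncomputable instance (n : ℕ) : InnerProductSpace ℝ (𝓔.EnergySpace n) :=
  InnerProductSpace.ofCore (𝓔.energyCore n).toCore

theorem inner_energySpace {n : ℕ} (u v : 𝓔.EnergySpace n) :
    inner ℝ u v = 𝓔.form (𝓔.ofEnergySpace n u) (𝓔.ofEnergySpace n v) +
      (n + 1) * inner ℝ (𝓔.ofEnergySpace n u : Lp ℝ 2 μ) (𝓔.ofEnergySpace n v : Lp ℝ 2 μ) := rfl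

theorem norm_sq_energySpace {n : ℕ} (u : 𝓔.EnergySpace n) :
    ‖u‖ ^ 2 = 𝓔.form (𝓔.ofEnergySpace n u) (𝓔.ofEnergySpace n u) +
      (n + 1) * ‖(𝓔.ofEnergySpace n u : Lp ℝ 2 μ)‖ ^ 2 := by
  rw [← real_inner_self_eq_norm_sq, inner_energySpace, real_inner_self_eq_norm_sq]

/-- The squared norm lies between the quantity `form u u + ‖u‖²` of `closed` and `n + 1` times it,
so completeness is exactly closedness of the form. -/
instance (n : ℕ) : CompleteSpace (𝓔.EnergySpace n) := by
  refine Metric.complete_of_cauchySeq_tendsto fun u hu => ?_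
  have hn : (0 : ℝ) ≤ n := n.cast_nonneg
  obtain ⟨v, hv⟩ := 𝓔.closed (fun k => 𝓔.ofEnergySpace n (u k)) fun ε hε => by
    obtain ⟨N, hN⟩ := Metric.cauchySeq_iff.mp hu (√ε) (Real.sqrt_pos.mpr hε)
    refine ⟨N, fun m hm k hk => ?_⟩
    have h1 := hN m hm k hk
    rw [dist_eq_norm] at h1
    have h2 : ‖u m - u k‖ ^ 2 < ε := by
      rw [← Real.sq_sqrt hε.le]
      gcongr
    rw [norm_sq_energySpace, map_sub] at h2
    nlinarith [sq_nonneg ‖((𝓔.ofEnergySpace n (u m) - 𝓔.ofEnergySpace n (u k) : 𝓔.domain) :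
      Lp ℝ 2 μ)‖]
  refine ⟨(𝓔.ofEnergySpace n).symm v, ?_⟩
  rw [tendsto_iff_norm_sub_tendsto_zero]
  have h3 : Tendsto (fun k => ‖u k - (𝓔.ofEnergySpace n).symm v‖ ^ 2) atTop (𝓝 0) := by
    refine squeeze_zero (fun _ => by positivity) (fun k => ?_)
      (by simpa only [mul_zero] using hv.const_mul ((n : ℝ) + 1))
    rw [norm_sq_energySpace, map_sub, LinearEquiv.apply_symm_apply]
    have h4 := mul_le_mul_of_nonneg_right (le_add_of_nonneg_left hn : (1 : ℝ) ≤ n + 1)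
      (𝓔.nonneg (𝓔.ofEnergySpace n (u k) - v))
    rw [mul_add]
    linarith
  simpa using h3.sqrt

/-- The inclusion of the energy space into `L²`. -/
noncomputable def energyInclusion (n : ℕ) : 𝓔.EnergySpace n →L[ℝ] Lp ℝ 2 μ :=
  LinearMap.mkContinuous (𝓔.domain.subtype ∘ₗ (𝓔.ofEnergySpace n).toLinearMap) 1 fun u => by
    have h1 := 𝓔.norm_sq_energySpace u
    have h2 := 𝓔.nonneg (𝓔.ofEnergySpace n u)
    have hn : (0 : ℝ) ≤ n := n.cast_nonneg
    rw [one_mul]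
    change ‖(𝓔.ofEnergySpace n u : Lp ℝ 2 μ)‖ ≤ _
    refine le_of_sq_le_sq ?_ (norm_nonneg _)
    nlinarith [sq_nonneg ‖(𝓔.ofEnergySpace n u : Lp ℝ 2 μ)‖]

theorem energyInclusion_apply {n : ℕ} (u : 𝓔.EnergySpace n) :
    𝓔.energyInclusion n u = (𝓔.ofEnergySpace n u : Lp ℝ 2 μ) := rfl

/-- The normalized resolvent `β G_β` of the form at `β = n + 1`, as a map into the domain. -/
noncomputable def resolvent (n : ℕ) : Lp ℝ 2 μ →ₗ[ℝ] 𝓔.domain :=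
  ((n : ℝ) + 1) • (𝓔.ofEnergySpace n).toLinearMap ∘ₗ
    (ContinuousLinearMap.adjoint (𝓔.energyInclusion n)).toLinearMap

/-- The adjoint of the inclusion into `L²` is `G_β`, as it represents `⟪u, ·⟫` in the inner product
`𝓔 + β ⟪·, ·⟫`; multiplying by `β` gives the identity. Symmetry, energy bounds and the Markov
property of the resolvent all rest on it. -/
theorem form_resolvent (n : ℕ) (u : Lp ℝ 2 μ) (v : 𝓔.domain) :
    𝓔.form (𝓔.resolvent n u) v =
      (n + 1) * (inner ℝ u (v : Lp ℝ 2 μ) - inner ℝ (𝓔.resolvent n u : Lp ℝ 2 μ) (v : Lp ℝ 2 μ)) := by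
  have h := ContinuousLinearMap.adjoint_inner_left (𝓔.energyInclusion n)
    ((𝓔.ofEnergySpace n).symm v) u
  rw [inner_energySpace, energyInclusion_apply, LinearEquiv.apply_symm_apply] at h
  have hr : 𝓔.resolvent n u = ((n : ℝ) + 1) • 𝓔.ofEnergySpace n
    (ContinuousLinearMap.adjoint (𝓔.energyInclusion n) u) := rfl
  rw [hr, map_smul, LinearMap.smul_apply, smul_eq_mul, Submodule.coe_smul, real_inner_smul_left,
    ← h]
  ring

theorem inner_resolvent_comm (n : ℕ) (u v : Lp ℝ 2 μ) :
    inner ℝ (𝓔.resolvent n u : Lp ℝ 2 μ) v = inner ℝ u (𝓔.resolvent n v : Lp ℝ 2 μ) := by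
  have h1 := 𝓔.form_resolvent n u (𝓔.resolvent n v)
  have h2 := 𝓔.form_resolvent n v (𝓔.resolvent n u)
  rw [𝓔.symm, h1] at h2
  have hn : (n : ℝ) + 1 ≠ 0 := by positivity
  have h3 := mul_left_cancel₀ hn h2
  rw [real_inner_comm (𝓔.resolvent n u : Lp ℝ 2 μ) (𝓔.resolvent n v : Lp ℝ 2 μ)] at h3
  rw [real_inner_comm v]
  linarith

theorem form_sq_le (u v : 𝓔.domain) : 𝓔.form u v ^ 2 ≤ 𝓔.form u u * 𝓔.form v v := by
  have h := LinearMap.BilinForm.apply_mul_apply_le_of_forall_zero_le 𝓔.form 𝓔.nonneg u v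
  rwa [𝓔.symm v u, ← sq] at h

/-- Testing `form_resolvent` with `v = u - R u` gives `𝓔(R u, u - R u) = β ‖u - R u‖²`. -/
theorem form_resolvent_self_eq (n : ℕ) (u : 𝓔.domain) :
    𝓔.form (𝓔.resolvent n u) (𝓔.resolvent n u) + (n + 1) * ‖(u - 𝓔.resolvent n u : Lp ℝ 2 μ)‖ ^ 2
      = 𝓔.form (𝓔.resolvent n u) u := by
  rw [form_resolvent, form_resolvent, ← real_inner_self_eq_norm_sq]
  simp only [inner_sub_left, inner_sub_right]
  rw [real_inner_comm (u : Lp ℝ 2 μ)]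
  ring

/-- Cauchy–Schwarz with the preceding identity: `𝓔(R u, u)² ≤ 𝓔(R u, R u) 𝓔(u, u) ≤ 𝓔(R u, u) 𝓔(u,
u)`. -/
theorem form_resolvent_le (n : ℕ) (u : 𝓔.domain) : 𝓔.form (𝓔.resolvent n u) u ≤ 𝓔.form u u := by
  have h1 := 𝓔.form_resolvent_self_eq n u
  have h2 := 𝓔.form_sq_le (𝓔.resolvent n u) u
  have h3 := 𝓔.nonneg (𝓔.resolvent n u)
  have h4 := 𝓔.nonneg u
  have h5 : 0 ≤ ((n : ℝ) + 1) * ‖(u - 𝓔.resolvent n u : Lp ℝ 2 μ)‖ ^ 2 := by positivity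
  by_contra! hlt
  nlinarith

theorem tendsto_resolvent (u : 𝓔.domain) :
    Tendsto (fun n => (𝓔.resolvent n u : Lp ℝ 2 μ)) atTop (𝓝 u) := by
  rw [tendsto_iff_norm_sub_tendsto_zero]
  have h3 : Tendsto (fun n => ‖(𝓔.resolvent n u - u : Lp ℝ 2 μ)‖ ^ 2) atTop (𝓝 0) := by
    refine squeeze_zero (g := fun n : ℕ => 𝓔.form u u * (1 / ((n : ℝ) + 1)))
      (fun _ => by positivity) (fun n => ?_)
      (by simpa using tendsto_one_div_add_atTop_nhds_zero_nat.const_mul (𝓔.form u u))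
    have h1 := 𝓔.form_resolvent_self_eq n u
    have h2 := 𝓔.form_resolvent_le n u
    have h4 := 𝓔.nonneg (𝓔.resolvent n u)
    rw [mul_one_div, le_div_iff₀ (by positivity), norm_sub_rev]
    linarith
  simpa using h3.sqrt

/-- The orthogonal complement of the range of an adjoint is the kernel of the operator, here an
injective inclusion. For `n = 0` the energy norm dominates the form. -/
theorem dense_resolvent (v : 𝓔.domain) {ε : ℝ} (hε : 0 < ε) :
    ∃ h : Lp ℝ 2 μ, 𝓔.form (v - 𝓔.resolvent 0 h) (v - 𝓔.resolvent 0 h) < ε := by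
  have hd : (LinearMap.range (ContinuousLinearMap.adjoint
      (𝓔.energyInclusion 0)).toLinearMap).topologicalClosure = ⊤ := by
    rw [Submodule.topologicalClosure_eq_top_iff, Submodule.eq_bot_iff]
    intro w hw
    have h1 : inner ℝ (ContinuousLinearMap.adjoint (𝓔.energyInclusion 0)
        (𝓔.energyInclusion 0 w)) w = 0 :=
      (Submodule.mem_orthogonal _ _).mp hw _ ⟨_, rfl⟩
    rw [ContinuousLinearMap.adjoint_inner_left] at h1
    exact Subtype.ext (inner_self_eq_zero.mp h1)
  have hv : (𝓔.ofEnergySpace 0).symm v ∈ closure (LinearMap.range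
      (ContinuousLinearMap.adjoint (𝓔.energyInclusion 0)).toLinearMap : Set (𝓔.EnergySpace 0)) := by
    rw [← Submodule.topologicalClosure_coe, hd]
    trivial
  obtain ⟨_, ⟨h, rfl⟩, hlt⟩ := Metric.mem_closure_iff.mp hv (√ε) (Real.sqrt_pos.mpr hε)
  refine ⟨h, ?_⟩
  rw [dist_eq_norm] at hlt
  have h2 := pow_lt_pow_left₀ hlt (norm_nonneg _) two_ne_zero
  rw [norm_sq_energySpace, Real.sq_sqrt hε.le, map_sub, LinearEquiv.apply_symm_apply] at h2
  have hr : 𝓔.resolvent 0 h = 𝓔.ofEnergySpace 0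
    (ContinuousLinearMap.adjoint (𝓔.energyInclusion 0) h) := by
      simp [resolvent]
  rw [hr]
  refine lt_of_le_of_lt ?_ h2
  exact le_add_of_nonneg_right (by positivity)

/-- Weak convergence in energy: `R u - u` has bounded energy, so it is enough to test against the
dense range of `resolvent 0`. There the form becomes an `L²` inner product, and `R u → u` in `L²`.
-/
theorem tendsto_form_resolvent (u v : 𝓔.domain) :
    Tendsto (fun n => 𝓔.form (𝓔.resolvent n u) v) atTop (𝓝 (𝓔.form u v)) := by
  rw [Metric.tendsto_atTop]
  intro ε hε
  set K := 𝓔.form u u with hK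
  have hK0 : 0 ≤ K := 𝓔.nonneg u
  obtain ⟨h, hh⟩ := 𝓔.dense_resolvent v
    (show 0 < ε ^ 2 / (16 * (K + 1)) by positivity)
  have hbd : ∀ n, 𝓔.form (𝓔.resolvent n u - u) (𝓔.resolvent n u - u) ≤ 4 * K := fun n => by
    have h1 := 𝓔.form_resolvent_self_eq n u
    have h2 := 𝓔.form_resolvent_le n u
    have h5 : 0 ≤ ((n : ℝ) + 1) * ‖(u - 𝓔.resolvent n u : Lp ℝ 2 μ)‖ ^ 2 := by positivity
    have h6 : 𝓔.form (𝓔.resolvent n u) (𝓔.resolvent n u) ≤ (√K) ^ 2 := by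
      rw [Real.sq_sqrt hK0]; linarith
    have h7 := 𝓔.form_add_le (Real.sqrt_nonneg K) (Real.sqrt_nonneg K) h6
      (b := -u) (by rw [form_neg, Real.sq_sqrt hK0])
    rw [← sub_eq_add_neg] at h7
    refine h7.trans (le_of_eq ?_)
    rw [← two_mul, mul_pow, Real.sq_sqrt hK0]
    norm_num
  have hlim : Tendsto (fun n => 𝓔.form (𝓔.resolvent n u - u) (𝓔.resolvent 0 h)) atTop (𝓝 0) := by
    have h1 : ∀ n, 𝓔.form (𝓔.resolvent n u - u) (𝓔.resolvent 0 h) =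
        inner ℝ (h - 𝓔.resolvent 0 h : Lp ℝ 2 μ) (𝓔.resolvent n u - u : Lp ℝ 2 μ) := fun n => by
      rw [𝓔.symm, form_resolvent, inner_sub_left]
      simp
    simp only [h1]
    have h2 := (𝓔.tendsto_resolvent u).sub_const (u : Lp ℝ 2 μ)
    have h3 := (tendsto_const_nhds (x := (h - 𝓔.resolvent 0 h : Lp ℝ 2 μ))).inner (𝕜 := ℝ) h2
    simpa using h3
  obtain ⟨N, hN⟩ := Metric.tendsto_atTop.mp hlim (ε / 2) (by positivity)
  refine ⟨N, fun n hn => ?_⟩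
  have h1 := hN n hn
  rw [dist_zero_right, Real.norm_eq_abs] at h1
  have h2 : |𝓔.form (𝓔.resolvent n u - u) (v - 𝓔.resolvent 0 h)| ≤ ε / 2 := by
    refine abs_le_of_sq_le_sq ?_ (by positivity)
    refine (𝓔.form_sq_le _ _).trans ?_
    calc _ ≤ (4 * K) * (ε ^ 2 / (16 * (K + 1))) :=
          mul_le_mul (hbd n) hh.le (𝓔.nonneg _) (by positivity)
      _ ≤ (ε / 2) ^ 2 := by
          rw [mul_div_assoc', div_le_iff₀ (by positivity)]
          nlinarith [sq_nonneg ε]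
  rw [Real.dist_eq, ← LinearMap.sub_apply, ← map_sub]
  have h3 : 𝓔.form (𝓔.resolvent n u - u) v = 𝓔.form (𝓔.resolvent n u - u) (v - 𝓔.resolvent 0 h)
      + 𝓔.form (𝓔.resolvent n u - u) (𝓔.resolvent 0 h) := by
    rw [← map_add, sub_add_cancel]
  rw [h3]
  refine (abs_add_le _ _).trans_lt ?_
  linarith

/-- The normalized resolvent preserves upper bounds by positive constants. -/
theorem resolvent_le_of_pos (n : ℕ) {u : Lp ℝ 2 μ} {c : ℝ} (hc : 0 < c) (hu : ∀ᵐ x ∂μ, u x ≤ c) :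
    ∀ᵐ x ∂μ, (𝓔.resolvent n u : Lp ℝ 2 μ) x ≤ c := by
  set w := 𝓔.resolvent n u with hw
  -- `w` is the unique minimizer of `z ↦ 𝓔(z, z) + β ‖z - u‖²`, as the identity `hid` shows.
  -- Truncating `w` at `c` increases neither term, since `u ≤ c`; hence the truncation equals `w`.
  obtain ⟨v, hv, hE⟩ := 𝓔.exists_min w hc
  have hn : (0 : ℝ) < n + 1 := by positivity
  have hle : ‖(v - u : Lp ℝ 2 μ)‖ ≤ ‖(w - u : Lp ℝ 2 μ)‖ := by
    refine Lp.norm_le_norm_of_ae_le ?_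
    filter_upwards [hv, hu, Lp.coeFn_sub (v : Lp ℝ 2 μ) u, Lp.coeFn_sub (w : Lp ℝ 2 μ) u]
      with x h1 h2 h3 h4
    rw [h3, h4, Pi.sub_apply, Pi.sub_apply, h1, Real.norm_eq_abs, Real.norm_eq_abs]
    rcases le_total ((w : Lp ℝ 2 μ) x) c with h | h
    · rw [min_eq_left h]
    · rw [min_eq_right h, abs_of_nonneg (by linarith), abs_of_nonneg (by linarith)]
      linarith
  have hle2 : ‖(v - u : Lp ℝ 2 μ)‖ ^ 2 ≤ ‖(w - u : Lp ℝ 2 μ)‖ ^ 2 := by gcongr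
  have hid : 𝓔.form v v + (n + 1) * ‖(v - u : Lp ℝ 2 μ)‖ ^ 2 =
      𝓔.form w w + (n + 1) * ‖(w - u : Lp ℝ 2 μ)‖ ^ 2
      + 𝓔.form (v - w) (v - w) + (n + 1) * ‖(v - w : Lp ℝ 2 μ)‖ ^ 2 := by
    have h1 := 𝓔.form_resolvent n u v
    have h2 := 𝓔.form_resolvent n u w
    rw [← hw] at h1 h2
    simp only [← real_inner_self_eq_norm_sq, inner_sub_left, inner_sub_right, map_sub,
      LinearMap.sub_apply]
    rw [𝓔.symm v w, h1, h2, real_inner_comm (v : Lp ℝ 2 μ) u, real_inner_comm (w : Lp ℝ 2 μ) u,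
      real_inner_comm (v : Lp ℝ 2 μ) (w : Lp ℝ 2 μ)]
    ring
  have h0 : ‖(v - w : Lp ℝ 2 μ)‖ ^ 2 = 0 := by
    have := 𝓔.nonneg (v - w)
    nlinarith [sq_nonneg ‖(v - w : Lp ℝ 2 μ)‖]
  have hvw : (v : Lp ℝ 2 μ) = w := by
    rw [← sub_eq_zero, ← norm_eq_zero]
    exact pow_eq_zero_iff two_ne_zero |>.mp h0
  rw [hvw] at hv
  filter_upwards [hv] with x hx
  rw [hx]
  exact min_le_right _ _

/-- Truncation is available only at positive levels, so `c` is approached from above. The case `c =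
0` yields positivity preservation. -/
theorem resolvent_le (n : ℕ) {u : Lp ℝ 2 μ} {c : ℝ} (hc : 0 ≤ c) (hu : ∀ᵐ x ∂μ, u x ≤ c) :
    ∀ᵐ x ∂μ, (𝓔.resolvent n u : Lp ℝ 2 μ) x ≤ c := by
  have h : ∀ k : ℕ, ∀ᵐ x ∂μ, (𝓔.resolvent n u : Lp ℝ 2 μ) x ≤ c + 1 / ((k : ℝ) + 1) := fun k => by
    have hk : 0 < 1 / ((k : ℝ) + 1) := by positivity
    refine 𝓔.resolvent_le_of_pos n (by positivity) ?_
    filter_upwards [hu] with x hx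
    linarith
  filter_upwards [ae_all_iff.mpr h] with x hx
  have hlim : Tendsto (fun k : ℕ => c + 1 / ((k : ℝ) + 1)) atTop (𝓝 c) := by
    simpa using tendsto_one_div_add_atTop_nhds_zero_nat.const_add c
  exact ge_of_tendsto' hlim hx

theorem resolvent_nonneg (n : ℕ) {u : Lp ℝ 2 μ} (hu : ∀ᵐ x ∂μ, 0 ≤ u x) :
    ∀ᵐ x ∂μ, 0 ≤ (𝓔.resolvent n u : Lp ℝ 2 μ) x := by
  have h := 𝓔.resolvent_le n (u := -u) le_rfl (by
    filter_upwards [hu, Lp.coeFn_neg u] with x h1 h2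
    rw [h2, Pi.neg_apply]
    linarith)
  rw [map_neg] at h
  filter_upwards [h, Lp.coeFn_neg (𝓔.resolvent n u : Lp ℝ 2 μ)] with x h1 h2
  rw [Submodule.coe_neg, h2, Pi.neg_apply] at h1
  linarith

end Resolvent

end DirichletForm

/-! ### Approximating energy densities and their limit -/

/-- An `Lp` function vanishes off a σ-finite set, so sets of finite measure exhaust its integral
even though `μ` is arbitrary. On such sets the indicator lies in `L²` and can be paired with the
resolvent. -/
theorem MeasureTheory.Lp.lintegral_enorm_le_of_forall_setLIntegral_le {X E : Type*}
    [MeasurableSpace X] {μ : Measure X} [NormedAddCommGroup E] {p : ℝ≥0∞} (hp0 : p ≠ 0)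
    (hp : p ≠ ∞) (h : Lp E p μ) {C : ℝ≥0∞}
    (hC : ∀ s, MeasurableSet s → μ s ≠ ∞ → ∫⁻ x in s, ‖h x‖ₑ ∂μ ≤ C) :
    ∫⁻ x, ‖h x‖ₑ ∂μ ≤ C := by
  obtain ⟨t, ht, hzero, hσ⟩ := (Lp.finStronglyMeasurable h hp0 hp).exists_set_sigmaFinite
  have h1 : ∫⁻ x, ‖h x‖ₑ ∂μ = ∫⁻ x in t, ‖h x‖ₑ ∂μ := by
    rw [← lintegral_indicator ht]
    refine lintegral_congr fun x => ?_
    by_cases hx : x ∈ t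
    · rw [Set.indicator_of_mem hx]
    · rw [Set.indicator_of_notMem hx, hzero x hx, enorm_zero]
  rw [h1]
  refine lintegral_le_of_forall_fin_meas_le C fun s hs hfin => ?_
  rw [Measure.restrict_restrict hs]
  rw [Measure.restrict_apply hs] at hfin
  exact hC _ (hs.inter ht) hfin

theorem MeasureTheory.integral_sub_two_mul_add {X : Type*} [MeasurableSpace X] {μ : Measure X}
    {a b c : X → ℝ} (ha : Integrable a μ) (hb : Integrable b μ) (hc : Integrable c μ) :
    ∫ x, (a x - 2 * b x + c x) ∂μ = ∫ x, a x ∂μ - 2 * ∫ x, b x ∂μ + ∫ x, c x ∂μ := by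
  rw [integral_add (f := fun x => a x - 2 * b x) (ha.sub (hb.const_mul 2)) hc,
    integral_sub ha (hb.const_mul 2), integral_const_mul]

namespace DirichletForm

section CarreDuChamp

variable {X : Type*} [MeasurableSpace X] {μ : Measure X} {𝓔 : DirichletForm μ}

/-- The normalized resolvent contracts the `L¹`-norm of nonnegative functions. -/
theorem lintegral_resolvent_le (n : ℕ) {g : Lp ℝ 2 μ} (hg : ∀ᵐ x ∂μ, 0 ≤ g x)
    (hgi : Integrable g μ) :
    ∫⁻ x, ‖(𝓔.resolvent n g : Lp ℝ 2 μ) x‖ₑ ∂μ ≤ ENNReal.ofReal (∫ x, g x ∂μ) := by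
  refine Lp.lintegral_enorm_le_of_forall_setLIntegral_le two_ne_zero ENNReal.ofNat_ne_top _
    fun s hs hfin => ?_
  have hpos := 𝓔.resolvent_nonneg n hg
  have h1 : ∫⁻ x in s, ‖(𝓔.resolvent n g : Lp ℝ 2 μ) x‖ₑ ∂μ =
      ENNReal.ofReal (∫ x in s, (𝓔.resolvent n g : Lp ℝ 2 μ) x ∂μ) := by
    rw [ofReal_integral_eq_lintegral_ofReal
      (integrableOn_Lp_of_measure_ne_top _ fact_one_le_two_ennreal.elim hfin)
      (ae_restrict_of_ae hpos)]
    refine lintegral_congr_ae (ae_restrict_of_ae ?_)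
    filter_upwards [hpos] with x hx
    exact Real.enorm_of_nonneg hx
  rw [h1]
  refine ENNReal.ofReal_le_ofReal ?_
  -- By symmetry `∫_s R g = ⟪R 1_s, g⟫`, and `R 1_s ≤ 1` while `g ≥ 0`.
  rw [← L2.inner_indicatorConstLp_one (𝕜 := ℝ) hs hfin, ← inner_resolvent_comm, L2.inner_def]
  have hone := 𝓔.resolvent_le n (u := indicatorConstLp 2 hs hfin (1 : ℝ)) zero_le_one (by
    filter_upwards [indicatorConstLp_coeFn (p := 2) (hs := hs) (hμs := hfin) (c := (1 : ℝ))]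
      with x hx
    rw [hx]
    exact Set.indicator_apply_le' (fun _ => le_rfl) fun _ => zero_le_one)
  refine integral_mono_ae (L2.integrable_inner _ _) hgi ?_
  filter_upwards [hone, hg] with x h1 h2
  simp only [RCLike.inner_apply, conj_trivial]
  nlinarith

/-- The sub-Markovian Jensen inequality for the normalized resolvent, in polarized form. -/
theorem resolvent_sq_sub_nonneg (n : ℕ) {u g : Lp ℝ 2 μ} (hg : ∀ᵐ x ∂μ, g x = u x ^ 2) :
    ∀ᵐ x ∂μ, 0 ≤ (𝓔.resolvent n g : Lp ℝ 2 μ) x - 2 * u x * (𝓔.resolvent n u : Lp ℝ 2 μ) x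
      + u x ^ 2 := by
  -- Apply the resolvent bound to `2 q u - u² ≤ q²`. The exceptional null set depends on `q`, so
  -- only rational `q` are used; continuity in `q` then allows `q = u x`.
  have h : ∀ q : ℚ, ∀ᵐ x ∂μ, 0 ≤ (𝓔.resolvent n g : Lp ℝ 2 μ) x
      - 2 * q * (𝓔.resolvent n u : Lp ℝ 2 μ) x + q ^ 2 := fun q => by
    have h1 := 𝓔.resolvent_le n (u := (2 * q : ℝ) • u - g) (sq_nonneg (q : ℝ)) (by
      filter_upwards [hg, Lp.coeFn_sub ((2 * q : ℝ) • u) g, Lp.coeFn_smul (2 * q : ℝ) u]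
        with x h1 h2 h3
      rw [h2, Pi.sub_apply, h3, Pi.smul_apply, smul_eq_mul, h1]
      nlinarith [sq_nonneg ((q : ℝ) - u x)])
    rw [map_sub, map_smul, Submodule.coe_sub, Submodule.coe_smul] at h1
    filter_upwards [h1, Lp.coeFn_sub ((2 * q : ℝ) • (𝓔.resolvent n u : Lp ℝ 2 μ))
      (𝓔.resolvent n g : Lp ℝ 2 μ), Lp.coeFn_smul (2 * q : ℝ) (𝓔.resolvent n u : Lp ℝ 2 μ)]
      with x h1 h2 h3
    rw [h2, Pi.sub_apply, h3, Pi.smul_apply, smul_eq_mul] at h1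
    linarith
  filter_upwards [ae_all_iff.mpr h] with x hx
  have hclosed : IsClosed {c : ℝ | 0 ≤ (𝓔.resolvent n g : Lp ℝ 2 μ) x
      - 2 * c * (𝓔.resolvent n u : Lp ℝ 2 μ) x + c ^ 2} :=
    isClosed_le continuous_const (by fun_prop)
  exact Rat.denseRange_cast.induction_on (p := fun c : ℝ => 0 ≤ (𝓔.resolvent n g : Lp ℝ 2 μ) x
      - 2 * c * (𝓔.resolvent n u : Lp ℝ 2 μ) x + c ^ 2) (u x) hclosed hx

/-- The class in `L²` of a function in `𝓑(𝓔)`. -/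
noncomputable def toL2 (f : 𝓔.boundedDomain) : Lp ℝ 2 μ := toDomain f

theorem coeFn_toL2 (f : 𝓔.boundedDomain) : toL2 f =ᵐ[μ] (f : X → ℝ) := coeFn_toDomain f

theorem inner_toL2_left (f : 𝓔.boundedDomain) (v : Lp ℝ 2 μ) :
    inner ℝ (toL2 f) v = ∫ x, (f : X → ℝ) x * v x ∂μ := by
  rw [L2.inner_def]
  refine integral_congr_ae ?_
  filter_upwards [coeFn_toL2 f] with x hx
  simp only [RCLike.inner_apply, conj_trivial]
  rw [hx, mul_comm]

theorem integrable_mul_L2 (f : 𝓔.boundedDomain) (v : Lp ℝ 2 μ) :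
    Integrable (fun x => (f : X → ℝ) x * v x) μ := by
  refine (L2.integrable_inner (𝕜 := ℝ) (toL2 f) v).congr ?_
  filter_upwards [coeFn_toL2 f] with x hx
  simp only [RCLike.inner_apply, conj_trivial]
  rw [hx, mul_comm]

theorem integrable_mul (f g : 𝓔.boundedDomain) :
    Integrable (fun x => (f : X → ℝ) x * (g : X → ℝ) x) μ := integrable_coe (f * g)

theorem inner_toL2_toL2 (f g : 𝓔.boundedDomain) :
    inner ℝ (toL2 f) (toL2 g) = ∫ x, (f : X → ℝ) x * (g : X → ℝ) x ∂μ := by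
  rw [inner_toL2_left]
  refine integral_congr_ae ?_
  filter_upwards [coeFn_toL2 g] with x hx
  rw [hx]

/-- The density of the energy measure of `f` with respect to the approximating form
`u, v ↦ (n + 1) ⟪u - β G_β u, v⟫`, up to the factor `(n + 1) / 2`. -/
noncomputable def approxCarreDuChamp (n : ℕ) (f : 𝓔.boundedDomain) (x : X) : ℝ :=
  (𝓔.resolvent n (toL2 (f * f)) : Lp ℝ 2 μ) x
    - 2 * ((f : X → ℝ) x * (𝓔.resolvent n (toL2 f) : Lp ℝ 2 μ) x) + (f : X → ℝ) x ^ 2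

theorem toL2_mul_self (f : 𝓔.boundedDomain) : ∀ᵐ x ∂μ, toL2 (f * f) x = toL2 f x ^ 2 := by
  filter_upwards [coeFn_toL2 f, coeFn_toL2 (f * f)] with x h1 h2
  rw [h1, h2, sq]
  rfl

theorem approxCarreDuChamp_nonneg (n : ℕ) (f : 𝓔.boundedDomain) :
    ∀ᵐ x ∂μ, 0 ≤ approxCarreDuChamp n f x := by
  filter_upwards [𝓔.resolvent_sq_sub_nonneg n (toL2_mul_self f), coeFn_toL2 f] with x h1 h2
  rw [h2] at h1
  rw [approxCarreDuChamp]
  linarith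

theorem toL2_mul_self_nonneg (f : 𝓔.boundedDomain) : ∀ᵐ x ∂μ, 0 ≤ toL2 (f * f) x := by
  filter_upwards [toL2_mul_self f] with x h1
  rw [h1]
  exact sq_nonneg _

theorem integrable_toL2 (f : 𝓔.boundedDomain) : Integrable (toL2 f) μ :=
  (integrable_coe f).congr (coeFn_toL2 f).symm

theorem integrable_resolvent_sq (n : ℕ) (f : 𝓔.boundedDomain) :
    Integrable (𝓔.resolvent n (toL2 (f * f)) : Lp ℝ 2 μ) μ :=
  ⟨Lp.aestronglyMeasurable _, (lintegral_resolvent_le n (toL2_mul_self_nonneg f)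
    (integrable_toL2 _)).trans_lt ENNReal.ofReal_lt_top⟩

theorem integral_resolvent_sq_le (n : ℕ) (f : 𝓔.boundedDomain) :
    ∫ x, (𝓔.resolvent n (toL2 (f * f)) : Lp ℝ 2 μ) x ∂μ
      ≤ ∫ x, (f : X → ℝ) x * (f : X → ℝ) x ∂μ := by
  have h0 := lintegral_resolvent_le n (𝓔 := 𝓔) (toL2_mul_self_nonneg f) (integrable_toL2 _)
  have h1 : ∫ x, toL2 (f * f) x ∂μ = ∫ x, (f : X → ℝ) x * (f : X → ℝ) x ∂μ :=
    integral_congr_ae (coeFn_toL2 (f * f))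
  rw [h1] at h0
  have h2 : 0 ≤ ∫ x, (f : X → ℝ) x * (f : X → ℝ) x ∂μ :=
    integral_nonneg fun x => mul_self_nonneg _
  refine (le_abs_self _).trans ?_
  rw [← Real.norm_eq_abs]
  refine (norm_integral_le_lintegral_norm _).trans ?_
  refine ENNReal.toReal_le_of_le_ofReal h2 ?_
  simpa only [ofReal_norm] using h0

theorem integrable_approxCarreDuChamp (n : ℕ) (f : 𝓔.boundedDomain) :
    Integrable (approxCarreDuChamp n f) μ := by
  have h := ((integrable_resolvent_sq n f).sub
    ((integrable_mul_L2 f (𝓔.resolvent n (toL2 f) : Lp ℝ 2 μ)).const_mul 2)).add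
      (integrable_mul f f)
  refine h.congr (Eventually.of_forall fun x => ?_)
  simp [approxCarreDuChamp, sq]

/-- Since `∫ R(f²) ≤ ∫ f²`, the integral is at most `2 ⟪f - R f, f⟫`, and `β ⟪f - R f, f⟫ = 𝓔(R f,
f) ≤ 𝓔(f, f)`. This bounds the total masses uniformly in `n`. -/
theorem integral_approxCarreDuChamp_le (n : ℕ) (f : 𝓔.boundedDomain) :
    (n + 1) * ∫ x, approxCarreDuChamp n f x ∂μ ≤ 2 * energy f f := by
  have h1 : ∫ x, approxCarreDuChamp n f x ∂μ =
      ∫ x, (𝓔.resolvent n (toL2 (f * f)) : Lp ℝ 2 μ) x ∂μ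
        - 2 * inner ℝ (toL2 f) (𝓔.resolvent n (toL2 f) : Lp ℝ 2 μ)
        + inner ℝ (toL2 f) (toL2 f) := by
    rw [inner_toL2_left, inner_toL2_toL2, ← integral_sub_two_mul_add
      (integrable_resolvent_sq n f) (integrable_mul_L2 f _) (integrable_mul f f)]
    simp only [approxCarreDuChamp, sq]
  have h2 := integral_resolvent_sq_le n f
  rw [← inner_toL2_toL2] at h2
  have h3 := 𝓔.form_resolvent n (toL2 f) (toDomain f)
  have h4 := 𝓔.form_resolvent_le n (toDomain f)
  change _ ≤ energy f f at h4
  change 𝓔.form (𝓔.resolvent n (toL2 f)) (toDomain f) ≤ _ at h4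
  change _ = _ * (inner ℝ (toL2 f) (toL2 f) - inner ℝ _ (toL2 f)) at h3
  rw [inner_resolvent_comm] at h3
  rw [h3] at h4
  have hn : (0 : ℝ) < n + 1 := by positivity
  rw [h1]
  nlinarith [mul_le_mul_of_nonneg_left h2 hn.le]

/-- Expand both terms with `form_resolvent`, move `R` onto `f` and `f²` by symmetry, and use `⟪φ f,
f⟫ = ⟪φ, f²⟫`. -/
theorem approx_energy_eq (n : ℕ) (φ f : 𝓔.boundedDomain) :
    2 * 𝓔.form (𝓔.resolvent n (toL2 (φ * f))) (toDomain f)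
      - 𝓔.form (𝓔.resolvent n (toL2 φ)) (toDomain (f * f))
      = (n + 1) * ∫ x, (φ : X → ℝ) x * approxCarreDuChamp n f x ∂μ := by
  have e1 : inner ℝ (toL2 (φ * f)) (toL2 f) = inner ℝ (toL2 φ) (toL2 (f * f)) := by
    rw [inner_toL2_toL2, inner_toL2_toL2]
    refine integral_congr_ae (Eventually.of_forall fun x => ?_)
    exact mul_assoc _ _ _
  have h1 : ∫ x, (φ : X → ℝ) x * approxCarreDuChamp n f x ∂μ =
      inner ℝ (toL2 φ) (𝓔.resolvent n (toL2 (f * f)) : Lp ℝ 2 μ)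
        - 2 * inner ℝ (toL2 (φ * f)) (𝓔.resolvent n (toL2 f) : Lp ℝ 2 μ)
        + inner ℝ (toL2 φ) (toL2 (f * f)) := by
    rw [inner_toL2_left, inner_toL2_left, inner_toL2_toL2, ← integral_sub_two_mul_add
      (integrable_mul_L2 φ _) (integrable_mul_L2 (φ * f) _) (integrable_mul φ (f * f))]
    refine integral_congr_ae (Eventually.of_forall fun x => ?_)
    simp only [approxCarreDuChamp, NonUnitalSubalgebra.coe_mul, Pi.mul_apply]
    ring
  have h2 := 𝓔.form_resolvent n (toL2 (φ * f)) (toDomain f)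
  have h3 := 𝓔.form_resolvent n (toL2 φ) (toDomain (f * f))
  change _ = _ * (inner ℝ (toL2 (φ * f)) (toL2 f) - inner ℝ _ (toL2 f)) at h2
  change _ = _ * (inner ℝ (toL2 φ) (toL2 (f * f)) - inner ℝ _ (toL2 (f * f))) at h3
  rw [inner_resolvent_comm] at h2 h3
  rw [h1, h2, h3, e1]
  ring

/-- The functional `φ ↦ 𝓔(φ f, f) - 𝓔(φ, f²) / 2`, the energy measure of `f`. -/
noncomputable def energyFunctional (f φ : 𝓔.boundedDomain) : ℝ :=
  energy (φ * f) f - energy φ (f * f) / 2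

theorem tendsto_energyFunctional (f φ : 𝓔.boundedDomain) :
    Tendsto (fun n : ℕ => ((n : ℝ) + 1) * ∫ x, (φ : X → ℝ) x * approxCarreDuChamp n f x ∂μ) atTop
      (𝓝 (2 * energyFunctional f φ)) := by
  have h1 := 𝓔.tendsto_form_resolvent (toDomain (φ * f)) (toDomain f)
  have h2 := 𝓔.tendsto_form_resolvent (toDomain φ) (toDomain (f * f))
  have h3 := (h1.const_mul 2).sub h2
  have h4 : 2 * energyFunctional f φ = 2 * 𝓔.form (toDomain (φ * f)) (toDomain f)
      - 𝓔.form (toDomain φ) (toDomain (f * f)) := by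
    simp only [energyFunctional, energy]
    ring
  rw [h4]
  exact h3.congr fun n => approx_energy_eq n φ f

theorem energyFunctional_nonneg (f : 𝓔.boundedDomain) {φ : 𝓔.boundedDomain}
    (hφ : ∀ x, 0 ≤ (φ : X → ℝ) x) : 0 ≤ energyFunctional f φ := by
  have h : 0 ≤ 2 * energyFunctional f φ := by
    refine ge_of_tendsto' (tendsto_energyFunctional f φ) fun n => ?_
    refine mul_nonneg (by positivity) (integral_nonneg_of_ae ?_)
    filter_upwards [approxCarreDuChamp_nonneg n f] with x hx
    exact mul_nonneg (hφ x) hx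
  linarith

/-- The uniform mass bound survives the limit. It makes the functional continuous for the supremum
norm, hence extendable to all of `C₀(Δ, ℝ)`. -/
theorem abs_energyFunctional_le (f : 𝓔.boundedDomain) {φ : 𝓔.boundedDomain} {C : ℝ} (hC : 0 ≤ C)
    (hφ : ∀ x, |(φ : X → ℝ) x| ≤ C) : |energyFunctional f φ| ≤ C * energy f f := by
  have h : |2 * energyFunctional f φ| ≤ C * (2 * energy f f) := by
    refine le_of_tendsto' (tendsto_energyFunctional f φ).abs fun n => ?_
    refine le_trans ?_ (mul_le_mul_of_nonneg_left (integral_approxCarreDuChamp_le n f) hC)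
    have hn : (0 : ℝ) < n + 1 := by positivity
    rw [abs_mul, abs_of_pos hn, mul_left_comm]
    refine mul_le_mul_of_nonneg_left ?_ hn.le
    rw [← integral_const_mul, ← Real.norm_eq_abs]
    refine norm_integral_le_of_norm_le ((integrable_approxCarreDuChamp n f).const_mul C) ?_
    filter_upwards [approxCarreDuChamp_nonneg n f] with x hx
    rw [norm_mul, Real.norm_eq_abs, Real.norm_eq_abs, abs_of_nonneg hx]
    exact mul_le_mul_of_nonneg_right (hφ x) hx
  rw [abs_mul, abs_two] at h
  linarith

end CarreDuChamp

end DirichletForm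

/-! ### Density and representation of functionals on `C₀(Y, ℝ)` -/

namespace ZeroAtInftyContinuousMap

open scoped CompactlySupported

section VanishingAtInfinity

variable {Y : Type*} [TopologicalSpace Y]

theorem norm_le_iff {f : C₀(Y, ℝ)} {C : ℝ} (hC : 0 ≤ C) : ‖f‖ ≤ C ↔ ∀ y, |f y| ≤ C := by
  rw [← norm_toBCF_eq_norm, BoundedContinuousFunction.norm_le hC]
  rfl

theorem abs_apply_le_norm (f : C₀(Y, ℝ)) (y : Y) : |f y| ≤ ‖f‖ :=
  (norm_le_iff (norm_nonneg f)).mp le_rfl y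

/-- Post-composition with a continuous function vanishing at zero. -/
def postcomp (θ : C(ℝ, ℝ)) (hθ : θ 0 = 0) (f : C₀(Y, ℝ)) : C₀(Y, ℝ) where
  toContinuousMap := θ.comp f.toContinuousMap
  zero_at_infty' := by
    have h := (θ.continuous.tendsto 0).comp f.zero_at_infty'
    rwa [hθ] at h

/-- The **Stone–Weierstrass theorem** on a locally compact space: a subalgebra of `C₀(Y, ℝ)` which
separates points and vanishes nowhere is dense. -/
theorem dense_of_separatesPoints [LocallyCompactSpace Y] [T2Space Y]
    (B : NonUnitalSubalgebra ℝ C₀(Y, ℝ)) (hsep : ∀ y z, y ≠ z → ∃ b ∈ B, b y ≠ b z)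
    (hvan : ∀ y, ∃ b ∈ B, b y ≠ 0) : Dense (B : Set C₀(Y, ℝ)) := by
  let ext (g : C₀(Y, ℝ)) : C(OnePoint Y, ℝ) := OnePoint.continuousMapMk g.toContinuousMap 0
    (by rw [coclosedCompact_eq_cocompact]; exact g.zero_at_infty')
  -- The unitization of `B`: constants plus extensions of elements of `B` to the one-point
  -- compactification. Vanishing nowhere is what separates points of `Y` from infinity.
  let A : Subalgebra ℝ C(OnePoint Y, ℝ) :=
    { carrier := {F | ∃ b ∈ B, ∀ y : Y, F y = F OnePoint.infty + b y}
      mul_mem' := by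
        rintro F G ⟨b, hb, hF⟩ ⟨b', hb', hG⟩
        refine ⟨F OnePoint.infty • b' + G OnePoint.infty • b + b * b',
          B.add_mem (B.add_mem (B.smul_mem _ hb') (B.smul_mem _ hb)) (B.mul_mem hb hb'),
          fun y => ?_⟩
        simp only [ContinuousMap.mul_apply, hF, hG, add_apply, smul_apply, mul_apply, smul_eq_mul]
        ring
      add_mem' := by
        rintro F G ⟨b, hb, hF⟩ ⟨b', hb', hG⟩
        refine ⟨b + b', B.add_mem hb hb', fun y => ?_⟩
        simp only [ContinuousMap.add_apply, hF, hG, add_apply]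
        ring
      algebraMap_mem' := fun r => ⟨0, B.zero_mem, fun y => by simp⟩ }
  have hext : ∀ b ∈ B, ext b ∈ A := fun b hb => ⟨b, hb, fun y => (zero_add _).symm⟩
  have hA : A.SeparatesPoints := by
    intro y z hyz
    induction y using OnePoint.rec with
    | infty =>
      induction z using OnePoint.rec with
      | infty => exact absurd rfl hyz
      | coe z =>
        obtain ⟨b, hb, hbz⟩ := hvan z
        exact ⟨_, ⟨ext b, hext b hb, rfl⟩, fun h => hbz h.symm⟩
    | coe y =>
      induction z using OnePoint.rec with
      | infty =>
        obtain ⟨b, hb, hby⟩ := hvan y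
        exact ⟨_, ⟨ext b, hext b hb, rfl⟩, hby⟩
      | coe z =>
        obtain ⟨b, hb, hbyz⟩ := hsep y z fun h => hyz (congrArg _ h)
        exact ⟨_, ⟨ext b, hext b hb, rfl⟩, hbyz⟩
  intro g
  rw [Metric.mem_closure_iff]
  intro ε hε
  obtain ⟨⟨F, b, hb, hF⟩, hFg⟩ :=
    ContinuousMap.exists_mem_subalgebra_near_continuousMap_of_separatesPoints A hA (ext g)
      (ε / 3) (by positivity)
  have hnear : ∀ y, |F y - ext g y| < ε / 3 :=
    fun y => ((F - ext g).norm_coe_le_norm y).trans_lt hFg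
  -- `b = F - F(∞)`, and `F(∞)` is itself within `ε / 3` of `g(∞) = 0`, so the error is at most `2 ε
  -- / 3`.
  refine ⟨b, hb, ?_⟩
  rw [dist_eq_norm]
  refine lt_of_le_of_lt ((norm_le_iff (C := 2 * (ε / 3)) (by positivity)).mpr fun y => ?_)
    (by linarith)
  have h1 := hnear y
  have h2 := hnear OnePoint.infty
  have h3 : ext g y = g y := rfl
  have h4 : ext g OnePoint.infty = 0 := rfl
  rw [h3, hF y] at h1
  rw [h4, sub_zero] at h2
  rw [abs_lt] at h1 h2
  rw [sub_apply, abs_le]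
  constructor <;> linarith

/-- A compactly supported continuous function as a function vanishing at infinity. -/
def ofCompactlySupported : C_c(Y, ℝ) →ₗ[ℝ] C₀(Y, ℝ) where
  toFun f := ⟨f.toContinuousMap, zero_at_infty f⟩
  map_add' _ _ := rfl
  map_smul' _ _ := rfl

theorem ofCompactlySupported_apply (f : C_c(Y, ℝ)) (y : Y) : ofCompactlySupported f y = f y := rfl

theorem dense_range_ofCompactlySupported [T2Space Y] :
    DenseRange (ofCompactlySupported : C_c(Y, ℝ) → C₀(Y, ℝ)) := by
  intro g
  rw [Metric.mem_closure_iff]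
  intro ε hε
  have hδ : 0 < ε / 2 := by positivity
  -- Soft thresholding: zero on `[-ε/2, ε/2]` and a shift by `ε/2` towards zero elsewhere. Thus `θ ∘
  -- g` is uniformly close to `g` and supported in the compact set where `|g| ≥ ε/2`.
  let θ : C(ℝ, ℝ) := ⟨fun s => max (s - ε / 2) 0 + min (s + ε / 2) 0, by fun_prop⟩
  have hθ : ∀ s, |s| < ε / 2 → θ s = 0 := fun s hs => by
    rw [abs_lt] at hs
    change max (s - ε / 2) 0 + min (s + ε / 2) 0 = 0
    rw [max_eq_right (by linarith), min_eq_right (by linarith), add_zero]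
  have hθ2 : ∀ s, |s - θ s| ≤ ε / 2 := fun s => by
    change |s - (max (s - ε / 2) 0 + min (s + ε / 2) 0)| ≤ ε / 2
    rw [abs_le]
    rcases max_cases (s - ε / 2) 0 with h | h <;> rcases min_cases (s + ε / 2) 0 with h' | h' <;>
      constructor <;> linarith [h.1, h.2, h'.1, h'.2]
  obtain ⟨K, hK, hKg⟩ := mem_cocompact.mp
    (Metric.tendsto_nhds.mp g.zero_at_infty' (ε / 2) hδ)
  have hcl : IsClosed {y | ε / 2 ≤ |g y|} := isClosed_le continuous_const (map_continuous g).abs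
  have hsub : {y | ε / 2 ≤ |g y|} ⊆ K := fun y hy => by
    by_contra hyK
    have h1 : dist (g y) 0 < ε / 2 := hKg hyK
    rw [dist_zero_right, Real.norm_eq_abs] at h1
    exact absurd hy (not_le.mpr h1)
  let f : C_c(Y, ℝ) :=
    { toContinuousMap := θ.comp g.toContinuousMap
      hasCompactSupport' := by
        refine HasCompactSupport.of_support_subset_isCompact (hK.of_isClosed_subset hcl hsub) ?_
        intro y hy
        by_contra hlt
        exact hy (hθ _ (not_le.mp hlt)) }
  refine ⟨_, ⟨f, rfl⟩, ?_⟩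
  rw [dist_eq_norm]
  exact lt_of_le_of_lt ((norm_le_iff hδ.le).mpr fun y => hθ2 (g y)) (by linarith)

section Integration

variable [MeasurableSpace Y] [BorelSpace Y]

theorem integrable_of_isFiniteMeasure (Γ : Measure Y) [IsFiniteMeasure Γ] (g : C₀(Y, ℝ)) :
    Integrable g Γ := g.toBCF.integrable Γ

theorem continuous_integral (Γ : Measure Y) [IsFiniteMeasure Γ] :
    Continuous fun g : C₀(Y, ℝ) => ∫ y, g y ∂Γ := by
  let I : C₀(Y, ℝ) →ₗ[ℝ] ℝ :=
    { toFun := fun g => ∫ y, g y ∂Γ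
      map_add' := fun f g => integral_add (integrable_of_isFiniteMeasure Γ f)
        (integrable_of_isFiniteMeasure Γ g)
      map_smul' := fun c g => integral_const_mul c _ }
  refine (I.mkContinuous (Γ.real Set.univ) fun g => ?_).continuous
  rw [mul_comm]
  exact norm_integral_le_of_norm_le_const (Eventually.of_forall fun y => abs_apply_le_norm g y)

variable [LocallyCompactSpace Y] [T2Space Y]

/-- **Riesz–Markov–Kakutani** for positive continuous functionals on `C₀(Y, ℝ)`. -/
theorem exists_isFiniteMeasure_regular_of_nonneg (L : StrongDual ℝ C₀(Y, ℝ))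
    (hL : ∀ g : C₀(Y, ℝ), (∀ y, 0 ≤ g y) → 0 ≤ L g) :
    ∃ Γ : Measure Y, IsFiniteMeasure Γ ∧ Γ.Regular ∧ ∀ g : C₀(Y, ℝ), ∫ y, g y ∂Γ = L g := by
  let Λ : C_c(Y, ℝ) →ₚ[ℝ] ℝ := PositiveLinearMap.mk₀ (L.toLinearMap ∘ₗ ofCompactlySupported)
    fun f hf => hL _ fun y => hf y
  have hΛ : ∀ f, Λ f = L (ofCompactlySupported f) := fun _ => rfl
  -- The total mass is at most `‖L‖`: each compact `K` lies under a Urysohn function `F` with values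
  -- in `[0, 1]`, so its measure is at most `L F ≤ ‖L‖`.
  have hfin : IsFiniteMeasure (RealRMK.rieszMeasure Λ) := by
    refine ⟨lt_of_le_of_lt ?_ (ENNReal.ofReal_lt_top (r := ‖L‖))⟩
    rw [isOpen_univ.measure_eq_iSup_isCompact]
    refine iSup₂_le fun K _ => iSup_le fun hK => ?_
    obtain ⟨f, hf1, hf2, -, hf3⟩ :=
      exists_continuousMap_one_of_isCompact_subset_isOpen hK isOpen_univ (Set.subset_univ K)
    let F : C_c(Y, ℝ) := ⟨f, hf2⟩
    refine (RealRMK.rieszMeasure_le_of_eq_one Λ (f := F) (fun y => (hf3 y).1) hK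
      fun y hy => hf1 hy).trans (ENNReal.ofReal_le_ofReal ?_)
    rw [hΛ]
    refine (le_abs_self _).trans ((L.le_opNorm _).trans ?_)
    refine mul_le_of_le_one_right (norm_nonneg _) ((norm_le_iff zero_le_one).mpr fun y => ?_)
    rw [abs_le]
    exact ⟨by linarith [(hf3 y).1, ofCompactlySupported_apply F y, show F y = f y from rfl],
      (hf3 y).2⟩
  refine ⟨RealRMK.rieszMeasure Λ, hfin, inferInstance, fun g => ?_⟩
  refine congrFun (dense_range_ofCompactlySupported.equalizer (continuous_integral _) L.continuous
    (funext fun f => ?_)) g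
  exact RealRMK.integral_rieszMeasure Λ f

/-- A bounded linear functional, nonnegative on squares, on a dense subalgebra of `C₀(Y, ℝ)` is
represented by a unique finite regular measure. -/
theorem existsUnique_measure_of_dense (B : NonUnitalSubalgebra ℝ C₀(Y, ℝ))
    (hB : Dense (B : Set C₀(Y, ℝ))) (Λ : B →ₗ[ℝ] ℝ) (C : ℝ)
    (hC : ∀ b : B, |Λ b| ≤ C * ‖(b : C₀(Y, ℝ))‖) (hpos : ∀ b : B, 0 ≤ Λ (b * b)) :
    ∃! Γ : Measure Y, IsFiniteMeasure Γ ∧ Γ.Regular ∧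
      ∀ b : B, ∫ y, (b : C₀(Y, ℝ)) y ∂Γ = Λ b := by
  obtain ⟨L, hLB, -⟩ := exists_extension_norm_eq (E := C₀(Y, ℝ)) B.toSubmodule
    (LinearMap.mkContinuous (Λ : B.toSubmodule →ₗ[ℝ] ℝ) C hC)
  have hLB' : ∀ b : B, L b = Λ b := hLB
  -- Positivity is assumed only on squares because `B` need not contain square roots. The inequality
  -- `0 ≤ L (g * g)` passes to the closure of `B`, and in `C₀(Y, ℝ)` every nonnegative function is a
  -- square.
  have hsq : ∀ g : C₀(Y, ℝ), 0 ≤ L (g * g) := fun g => by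
    refine hB.induction (P := fun g => 0 ≤ L (g * g)) (fun b hb => ?_) ?_ g
    · have := hLB' (⟨b, hb⟩ * ⟨b, hb⟩)
      exact (hpos ⟨b, hb⟩).trans this.ge
    · exact isClosed_le continuous_const (L.continuous.comp (continuous_id.mul continuous_id))
  have hL : ∀ g : C₀(Y, ℝ), (∀ y, 0 ≤ g y) → 0 ≤ L g := fun g hg => by
    have h1 : postcomp ⟨Real.sqrt, Real.continuous_sqrt⟩ Real.sqrt_zero g *
        postcomp ⟨Real.sqrt, Real.continuous_sqrt⟩ Real.sqrt_zero g = g :=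
      ext fun y => Real.mul_self_sqrt (hg y)
    rw [← h1]
    exact hsq _
  obtain ⟨Γ, h1, h2, h3⟩ := exists_isFiniteMeasure_regular_of_nonneg L hL
  refine ⟨Γ, ⟨h1, h2, fun b => (h3 b).trans (hLB' b)⟩, ?_⟩
  rintro Γ' ⟨h1', h2', h3'⟩
  -- Both integrals are continuous on `C₀(Y, ℝ)` and agree on the dense `B`; regular measures are
  -- determined by their integrals on `C_c(Y, ℝ)`.
  refine Measure.ext_of_integral_eq_on_compactlySupported fun f => ?_
  refine congrFun (Continuous.ext_on hB (continuous_integral Γ') (continuous_integral Γ)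
    fun b hb => ?_) (ofCompactlySupported f)
  exact (h3' ⟨b, hb⟩).trans ((h3 b).trans (hLB' ⟨b, hb⟩)).symm

end Integration

end VanishingAtInfinity

end ZeroAtInftyContinuousMap

/-! ### Transfer of the energy functional to the spectrum -/

namespace DirichletForm

section Spectrum

variable {X : Type*} [MeasurableSpace X] {μ : Measure X} {𝓔 : DirichletForm μ}

theorem exists_norm_sub_toAlgebra_lt (a : 𝓔.Alg) {ε : ℝ} (hε : 0 < ε) :
    ∃ f g : 𝓔.boundedDomain, ‖a - (toAlgebra f + Complex.I • toAlgebra g)‖ < ε := by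
  have ha : a.1 ∈ closure (𝓔.complexification : Set (lp (fun _ : X => ℂ) ∞)) := a.2
  obtain ⟨_, ⟨f, g, rfl⟩, h⟩ := Metric.mem_closure_iff.mp ha ε hε
  rw [dist_eq_norm] at h
  exact ⟨f, g, h⟩

/-- `𝓑(𝓔) + i 𝓑(𝓔)` is dense in the algebra. This is why the Gelfand transforms of `𝓑(𝓔)` alone
separate characters and vanish nowhere on the spectrum. -/
theorem weakDual_ext {ψ ψ' : WeakDual ℂ 𝓔.Alg}
    (h : ∀ f : 𝓔.boundedDomain, ψ (toAlgebra f) = ψ' (toAlgebra f)) : ψ = ψ' := by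
  refine DFunLike.ext _ _ fun a => ?_
  have hcl : IsClosed {a : 𝓔.Alg | ψ a = ψ' a} := isClosed_eq (map_continuous ψ) (map_continuous ψ')
  refine hcl.closure_subset (Metric.mem_closure_iff.mpr fun ε hε => ?_)
  obtain ⟨f, g, hfg⟩ := exists_norm_sub_toAlgebra_lt a hε
  refine ⟨_, ?_, by rwa [dist_eq_norm]⟩
  change ψ (toAlgebra f + Complex.I • toAlgebra g) = ψ' (toAlgebra f + Complex.I • toAlgebra g)
  rw [map_add, map_add, map_smul, map_smul, h, h]

theorem exists_gelfand_ne {χ χ' : 𝓔.Spectrum} (h : χ ≠ χ') :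
    ∃ f : 𝓔.boundedDomain, 𝓔.gelfand f χ ≠ 𝓔.gelfand f χ' := by
  by_contra! hall
  refine h (Subtype.ext (weakDual_ext fun f => ?_))
  change χ (toAlgebra f) = χ' (toAlgebra f)
  rw [← ofReal_gelfand_apply, ← ofReal_gelfand_apply, hall]

theorem exists_gelfand_ne_zero (χ : 𝓔.Spectrum) : ∃ f : 𝓔.boundedDomain, 𝓔.gelfand f χ ≠ 0 := by
  by_contra! hall
  refine χ.2.1 (weakDual_ext fun f => ?_)
  change χ (toAlgebra f) = 0
  rw [← ofReal_gelfand_apply, hall, Complex.ofReal_zero]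

/-- If `f̂(χ) ≠ 0`, the set where `|f̂| ≥ |f̂(χ)| / 2` is a compact neighbourhood of `χ`. -/
instance : LocallyCompactSpace 𝓔.Spectrum := by
  have : WeaklyLocallyCompactSpace 𝓔.Spectrum := ⟨fun χ => by
    obtain ⟨f, hf⟩ := exists_gelfand_ne_zero χ
    have hpos : 0 < |𝓔.gelfand f χ| := abs_pos.mpr hf
    refine ⟨_, isCompact_character_ge (toAlgebra f) (half_pos hpos), ?_⟩
    exact (map_continuous (𝓔.gelfand f)).abs.continuousAt.eventually_const_le (half_lt_self hpos)⟩
  infer_instance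

variable (𝓔) in
theorem dense_hatDomain : Dense (𝓔.hatDomain : Set C₀(𝓔.Spectrum, ℝ)) := by
  refine ZeroAtInftyContinuousMap.dense_of_separatesPoints _ (fun χ χ' h => ?_) fun χ => ?_
  · obtain ⟨f, hf⟩ := exists_gelfand_ne h
    exact ⟨_, (hat f).2, hf⟩
  · obtain ⟨f, hf⟩ := exists_gelfand_ne_zero χ
    exact ⟨_, (hat f).2, hf⟩

/-- The sup norm of a function is at most that of its Gelfand transform. -/
theorem abs_apply_le_norm_gelfand (f : 𝓔.boundedDomain) (x : X) :
    |(f : X → ℝ) x| ≤ ‖𝓔.gelfand f‖ := by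
  by_cases hx : (f : X → ℝ) x = 0
  · rw [hx, abs_zero]
    exact norm_nonneg _
  -- As `f x ≠ 0`, evaluation at `x` is a nonzero character, and `f̂` takes the value `f x` there.
  let ev : 𝓔.Alg →ₗ[ℂ] ℂ :=
    { toFun := fun a => a.1 x
      map_add' := fun _ _ => rfl
      map_smul' := fun _ _ => rfl }
  let ψ : WeakDual ℂ 𝓔.Alg := (ev.mkContinuous 1 fun a => by
    rw [one_mul]
    exact lp.norm_apply_le_norm ENNReal.top_ne_zero a.1 x : StrongDual ℂ 𝓔.Alg)
  have hψ : ψ (toAlgebra f) = ((f : X → ℝ) x : ℂ) := rfl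
  have hψ0 : ψ ≠ 0 := by
    intro h0
    rw [h0] at hψ
    change (0 : ℂ) = _ at hψ
    exact hx (by exact_mod_cast hψ.symm)
  let χ : 𝓔.Spectrum := ⟨ψ, hψ0, fun _ _ => rfl⟩
  exact ZeroAtInftyContinuousMap.abs_apply_le_norm (𝓔.gelfand f) χ

theorem preimage_add (u v : 𝓔.hatDomain) : preimage (u + v) = preimage u + preimage v := by
  refine 𝓔.gelfand_injective ?_
  rw [map_add, gelfand_preimage, gelfand_preimage, gelfand_preimage]
  rfl

theorem preimage_smul (c : ℝ) (u : 𝓔.hatDomain) : preimage (c • u) = c • preimage u := by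
  refine 𝓔.gelfand_injective ?_
  rw [map_smul, gelfand_preimage, gelfand_preimage]
  rfl

theorem preimage_mul (u v : 𝓔.hatDomain) : preimage (u * v) = preimage u * preimage v := by
  refine 𝓔.gelfand_injective ?_
  rw [map_mul, gelfand_preimage, gelfand_preimage, gelfand_preimage]
  rfl

theorem toDomain_eq {f : 𝓔.boundedDomain} {v : 𝓔.domain} (h : (v : Lp ℝ 2 μ) =ᵐ[μ] (f : X → ℝ)) :
    toDomain f = v :=
  Subtype.ext (Lp.ext ((coeFn_toDomain f).trans h.symm))

theorem toDomain_add (f g : 𝓔.boundedDomain) : toDomain (f + g) = toDomain f + toDomain g :=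
  toDomain_eq ((Lp.coeFn_add _ _).trans ((coeFn_toDomain f).add (coeFn_toDomain g)))

theorem toDomain_smul (c : ℝ) (f : 𝓔.boundedDomain) : toDomain (c • f) = c • toDomain f :=
  toDomain_eq ((Lp.coeFn_smul _ _).trans ((coeFn_toDomain f).const_smul c))

/-- The energy measure of `f`, as a linear functional on the Gelfand transforms. -/
noncomputable def hatEnergyFunctional (f : 𝓔.hatDomain) : 𝓔.hatDomain →ₗ[ℝ] ℝ where
  toFun φ := energyFunctional (preimage f) (preimage φ)
  map_add' φ ψ := by
    simp only [energyFunctional, energy, preimage_add, add_mul, toDomain_add, map_add,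
      LinearMap.add_apply]
    ring
  map_smul' c φ := by
    simp only [energyFunctional, energy, preimage_smul, smul_mul_assoc, toDomain_smul, map_smul,
      LinearMap.smul_apply, smul_eq_mul, RingHom.id_apply]
    ring

theorem two_mul_hatEnergyFunctional (f φ : 𝓔.hatDomain) :
    2 * hatEnergyFunctional f φ = 2 * hatEnergy (φ * f) f - hatEnergy φ (f * f) := by
  simp only [hatEnergyFunctional, LinearMap.coe_mk, AddHom.coe_mk, energyFunctional, hatEnergy,
    preimage_mul]
  ring

/-- Existence and uniqueness of the energy measures of the transferred form. -/
theorem existsUnique_hatEnergyMeasure (f : 𝓔.hatDomain) :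
    ∃! Γ : Measure 𝓔.Spectrum, IsFiniteMeasure Γ ∧ Γ.Regular ∧ ∀ φ : 𝓔.hatDomain,
      2 * ∫ y, (φ : C₀(𝓔.Spectrum, ℝ)) y ∂Γ
        = 2 * hatEnergy (φ * f) f - hatEnergy φ (f * f) := by
  simp only [← two_mul_hatEnergyFunctional, mul_right_inj' (two_ne_zero' ℝ)]
  refine ZeroAtInftyContinuousMap.existsUnique_measure_of_dense _ 𝓔.dense_hatDomain _
    (energy (preimage f) (preimage f)) (fun φ => ?_) fun φ => ?_
  · rw [mul_comm]
    refine abs_energyFunctional_le _ (norm_nonneg _) fun x => ?_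
    rw [← gelfand_preimage φ]
    exact abs_apply_le_norm_gelfand _ x
  -- The square of a Gelfand transform comes from the square of a function on `X`, which is
  -- pointwise nonnegative; positivity on `X` and on the spectrum need not be compared further.
  · refine energyFunctional_nonneg _ fun x => ?_
    rw [preimage_mul]
    exact mul_self_nonneg _

end Spectrum

end DirichletForm

/-! ### A Dirichlet form on `ℕ` without energy measures -/

/-- A finite measure on `ℕ` charging every point. -/
noncomputable def weightedNat : Measure ℕ := (Measure.count : Measure ℕ).toFinite

instance : IsFiniteMeasure weightedNat := by unfold weightedNat; infer_instance

/-- Every point has positive mass, so classes in `L²` are genuine sequences. -/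
theorem ae_weightedNat_iff {p : ℕ → Prop} : (∀ᵐ n ∂weightedNat, p n) ↔ ∀ n, p n := by
  rw [weightedNat, ae_toFinite, Measure.ae_count_iff]

theorem weightedNat_singleton_ne_zero (n : ℕ) : weightedNat {n} ≠ 0 := by
  intro h
  have h1 : ∀ᵐ m ∂weightedNat, m ≠ n := by
    rw [ae_iff]
    simpa using h
  exact ae_weightedNat_iff.mp h1 n rfl

/-- The sequences `n ↦ a + g n` with `a ∈ ℝ` and `g ∈ ℓ²`, encoded by `(a, g)`. -/
abbrev ConvergentSeq : Type := lp (fun _ : Option ℕ => ℝ) 2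

namespace ConvergentSeq

/-- The sequence `n ↦ a + g n` encoded by `(a, g)`. -/
def eval (h : ConvergentSeq) (n : ℕ) : ℝ := h none + h (some n)

theorem abs_eval_le (h : ConvergentSeq) (n : ℕ) : |eval h n| ≤ 2 * ‖h‖ := by
  have h1 := lp.norm_apply_le_norm two_ne_zero h none
  have h2 := lp.norm_apply_le_norm two_ne_zero h (some n)
  rw [Real.norm_eq_abs] at h1 h2
  exact (abs_add_le _ _).trans (by linarith)

theorem tendsto_eval (h : ConvergentSeq) : Tendsto (eval h) atTop (𝓝 (h none)) := by
  have h1 : Summable fun i => h i * h i := lp.summable_inner (𝕜 := ℝ) h h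
  have h2 := (h1.comp_injective (Option.some_injective ℕ)).tendsto_atTop_zero
  have h3 : Tendsto (fun n => h (some n)) atTop (𝓝 0) := by
    rw [tendsto_zero_iff_abs_tendsto_zero]
    have h4 := h2.sqrt
    rw [Real.sqrt_zero] at h4
    exact h4.congr fun n => Real.sqrt_mul_self_eq_abs _
  have h5 := h3.const_add (h none)
  rwa [add_zero] at h5

/-- The constant `a` is recovered as the limit of the sequence, then `g` by subtraction. The form
can therefore be defined on codes. -/
theorem eval_injective : Function.Injective eval := by
  intro h h' heq
  have h0 : h none = h' none := tendsto_nhds_unique (tendsto_eval h) (heq ▸ tendsto_eval h')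
  refine lp.ext (funext fun i => ?_)
  cases i with
  | none => exact h0
  | some n =>
    have h1 : h none + h (some n) = h' none + h' (some n) := congrFun heq n
    linarith

theorem memLp_eval (h : ConvergentSeq) : MemLp (eval h) 2 weightedNat :=
  MemLp.of_bound (measurable_of_countable _).aestronglyMeasurable (2 * ‖h‖)
    (Eventually.of_forall (abs_eval_le h))

/-- The class of a sequence in `L²`. -/
noncomputable def toLp : ConvergentSeq →ₗ[ℝ] Lp ℝ 2 weightedNat where
  toFun h := (memLp_eval h).toLp
  map_add' h h' := by
    rw [← MemLp.toLp_add]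
    congr 1
    funext n
    simp only [eval, lp.coeFn_add, Pi.add_apply]
    ring
  map_smul' c h := by
    rw [RingHom.id_apply, ← MemLp.toLp_const_smul]
    congr 1
    funext n
    simp only [eval, lp.coeFn_smul, Pi.smul_apply, smul_eq_mul]
    ring

theorem toLp_apply (h : ConvergentSeq) (n : ℕ) : toLp h n = eval h n :=
  ae_weightedNat_iff.mp (memLp_eval h).coeFn_toLp n

theorem toLp_injective : Function.Injective toLp := by
  intro h h' heq
  refine eval_injective (funext fun n => ?_)
  rw [← toLp_apply, heq, toLp_apply]

theorem exists_norm_toLp_le : ∃ C, ∀ h : ConvergentSeq, ‖toLp h‖ ≤ C * ‖h‖ := by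
  refine ⟨measureUnivNNReal weightedNat ^ (2 : ℝ≥0∞).toReal⁻¹ * 2, fun h => ?_⟩
  rw [mul_assoc]
  refine Lp.norm_le_of_ae_bound (by positivity) (ae_weightedNat_iff.mpr fun n => ?_)
  rw [toLp_apply]
  exact abs_eval_le h n

/-- The range contains the indicators of points, so a vector orthogonal to it vanishes at every
point. -/
theorem dense_range_toLp : Dense (LinearMap.range toLp : Set (Lp ℝ 2 weightedNat)) := by
  rw [Submodule.dense_iff_topologicalClosure_eq_top, Submodule.topologicalClosure_eq_top_iff,
    Submodule.eq_bot_iff]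
  intro v hv
  have hfin (n : ℕ) : weightedNat {n} ≠ ∞ := measure_ne_top _ _
  refine Lp.ext (ae_weightedNat_iff.mpr fun n => ?_)
  have h1 : toLp (lp.single 2 (some n) 1) =
      indicatorConstLp 2 (measurableSet_singleton n) (hfin n) (1 : ℝ) := by
    refine Lp.ext (ae_weightedNat_iff.mpr fun m => ?_)
    rw [toLp_apply, ae_weightedNat_iff.mp indicatorConstLp_coeFn m]
    simp [eval, Pi.single_apply, Set.indicator_apply]
  have h2 := (Submodule.mem_orthogonal _ _).mp hv _ ⟨_, h1⟩
  rw [L2.inner_indicatorConstLp_one, integral_singleton, smul_eq_mul, mul_eq_zero] at h2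
  have h3 : weightedNat.real {n} ≠ 0 :=
    ENNReal.toReal_ne_zero.mpr ⟨weightedNat_singleton_ne_zero n, hfin n⟩
  rw [h2.resolve_left h3, ae_weightedNat_iff.mp (Lp.coeFn_zero ℝ 2 weightedNat) n]
  rfl

/-- Truncation at `1` from above, on the level of codes. -/
noncomputable def truncateFun (h : ConvergentSeq) (i : Option ℕ) : ℝ :=
  i.elim (min (h none) 1) fun n => min (eval h n) 1 - min (h none) 1

/-- The Markov property in coordinates: `s ↦ min s 1` is 1-Lipschitz and does not increase `|s|`.
The limit becomes `min a 1`, and each deviation from the limit shrinks. -/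
theorem abs_truncateFun_le (h : ConvergentSeq) (i : Option ℕ) : |truncateFun h i| ≤ |h i| := by
  cases i with
  | none =>
    change |min (h none) 1| ≤ |h none|
    rcases le_total (h none) 1 with h1 | h1
    · rw [min_eq_left h1]
    · rw [min_eq_right h1, abs_one]
      exact h1.trans (le_abs_self _)
  | some n =>
    change |min (eval h n) 1 - min (h none) 1| ≤ |h (some n)|
    refine (abs_min_sub_min_le_max _ _ _ _).trans ?_
    rw [sub_self, abs_zero, max_eq_left (abs_nonneg _), eval, add_sub_cancel_left]

/-- Truncation at `1` from above. -/
noncomputable def truncate (h : ConvergentSeq) : ConvergentSeq :=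
  ⟨truncateFun h, (lp.memℓp h).mono' (abs_truncateFun_le h)⟩

theorem norm_truncate_le (h : ConvergentSeq) : ‖truncate h‖ ≤ ‖h‖ :=
  lp.norm_mono two_ne_zero (abs_truncateFun_le h)

theorem eval_truncate (h : ConvergentSeq) (n : ℕ) : eval (truncate h) n = min (eval h n) 1 := by
  change min (h none) 1 + (min (eval h n) 1 - min (h none) 1) = _
  ring

/-- The space of sequences, identified with its image in `L²`. -/
noncomputable def toRange : ConvergentSeq ≃ₗ[ℝ] LinearMap.range toLp :=
  LinearEquiv.ofInjective toLp toLp_injective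

theorem coe_toRange (h : ConvergentSeq) : (toRange h : Lp ℝ 2 weightedNat) = toLp h := rfl

/-- The form `𝓔(a + g, a' + g') = a a' + ⟪g, g'⟫`: a killing term and a jump term which charge
the limit point of the sequences, a point outside of `ℕ`. -/
noncomputable def dirichletForm : DirichletForm weightedNat where
  domain := LinearMap.range toLp
  form := (innerₗ ConvergentSeq).compl₁₂ toRange.symm.toLinearMap toRange.symm.toLinearMap
  symm u v := real_inner_comm (toRange.symm v) (toRange.symm u)
  nonneg u := real_inner_self_nonneg (x := toRange.symm u)
  dense := dense_range_toLp
  closed u hu := by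
    simp only [LinearMap.compl₁₂_apply, innerₗ_apply_apply, LinearEquiv.coe_coe,
      real_inner_self_eq_norm_sq] at hu ⊢
    -- The form is the squared norm of the code, so completeness of `ℓ²` supplies the limit; the
    -- `L²` part follows because it is bounded by `C` times the norm of the code.
    obtain ⟨C, hC⟩ := exists_norm_toLp_le
    have hcauchy : CauchySeq fun k => toRange.symm (u k) := by
      rw [Metric.cauchySeq_iff]
      intro ε hε
      obtain ⟨N, hN⟩ := hu (ε ^ 2) (by positivity)
      refine ⟨N, fun m hm n hn => ?_⟩
      have h1 := hN m hm n hn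
      rw [map_sub] at h1
      rw [dist_eq_norm]
      exact lt_of_pow_lt_pow_left₀ 2 hε.le
        (lt_of_le_of_lt (le_add_of_nonneg_right (by positivity)) h1)
    obtain ⟨h, hh⟩ := cauchySeq_tendsto_of_complete hcauchy
    rw [tendsto_iff_norm_sub_tendsto_zero] at hh
    refine ⟨toRange h, ?_⟩
    have hlim : Tendsto (fun k => (1 + C ^ 2) * ‖toRange.symm (u k) - h‖ ^ 2) atTop (𝓝 0) := by
      simpa using (hh.pow 2).const_mul (1 + C ^ 2)
    refine squeeze_zero (fun k => by positivity) (fun k => ?_) hlim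
    have h1 := hC (toRange.symm (u k) - h)
    have h2 : toLp (toRange.symm (u k) - h) =
        ((u k - toRange h : LinearMap.range toLp) : Lp ℝ 2 weightedNat) := by
      rw [← coe_toRange, map_sub, LinearEquiv.apply_symm_apply]
    rw [h2] at h1
    rw [map_sub, LinearEquiv.symm_apply_apply, add_mul, one_mul, ← mul_pow]
    gcongr
  markov u := by
    refine ⟨toRange (truncate (toRange.symm u)), ae_weightedNat_iff.mpr fun n => ?_, ?_⟩
    · rw [coe_toRange, toLp_apply, eval_truncate, ← toLp_apply, ← coe_toRange,
        LinearEquiv.apply_symm_apply]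
    · simp only [LinearMap.compl₁₂_apply, innerₗ_apply_apply, LinearEquiv.coe_coe,
        real_inner_self_eq_norm_sq, LinearEquiv.symm_apply_apply]
      gcongr
      exact norm_truncate_le _

theorem form_toRange (h h' : ConvergentSeq) :
    dirichletForm.form (toRange h) (toRange h') = inner ℝ h h' := by
  change inner ℝ (toRange.symm (toRange h)) (toRange.symm (toRange h')) = _
  rw [LinearEquiv.symm_apply_apply, LinearEquiv.symm_apply_apply]

/-- A sequence of the domain, as an element of `𝓑(𝓔)`. -/
noncomputable def toBoundedDomain (h : ConvergentSeq) : dirichletForm.boundedDomain :=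
  ⟨eval h, measurable_of_countable _, ⟨_, abs_eval_le h⟩, (memLp_eval h).integrable one_le_two,
    toRange h, ae_weightedNat_iff.mpr (toLp_apply h)⟩

theorem toDomain_toBoundedDomain (h : ConvergentSeq) :
    DirichletForm.toDomain (toBoundedDomain h) = toRange h :=
  DirichletForm.toDomain_eq (ae_weightedNat_iff.mpr (toLp_apply h))

theorem energy_toBoundedDomain (h h' : ConvergentSeq) :
    DirichletForm.energy (toBoundedDomain h) (toBoundedDomain h') = inner ℝ h h' := by
  rw [DirichletForm.energy, toDomain_toBoundedDomain, toDomain_toBoundedDomain, form_toRange]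

theorem exists_toBoundedDomain_eq (f : dirichletForm.boundedDomain) :
    ∃ h, toBoundedDomain h = f := by
  obtain ⟨⟨_, h, rfl⟩, hu⟩ := DirichletForm.hasEnergy_coe f
  refine ⟨h, Subtype.ext (funext fun n => ?_)⟩
  rw [← ae_weightedNat_iff.mp hu n]
  exact (toLp_apply h n).symm

theorem isSeparable_univ : TopologicalSpace.IsSeparable (Set.univ : Set ConvergentSeq) := by
  refine ((Set.countable_range fun i : Option ℕ => lp.single 2 i (1 : ℝ)).isSeparable.span
    (R := ℝ)).closure.mono fun h _ => ?_
  refine mem_closure_of_tendsto (lp.hasSum_single ENNReal.ofNat_ne_top h)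
    (Eventually.of_forall fun s => Submodule.sum_mem _ fun i _ => ?_)
  have h1 : lp.single 2 i (h i) = h i • lp.single (E := fun _ : Option ℕ => ℝ) 2 i (1 : ℝ) := by
    rw [← lp.single_smul, smul_eq_mul, mul_one]
  rw [h1]
  exact Submodule.smul_mem _ _ (Submodule.subset_span ⟨i, rfl⟩)

/-- `𝓑(𝓔)` is the image of the separable space of codes under a map that is 2-Lipschitz for the
supremum norm. -/
theorem supSeparable : dirichletForm.SupSeparable := by
  have hcont : Continuous fun h => DirichletForm.toBounded (toBoundedDomain h) := by
    refine (LipschitzWith.of_dist_le_mul (K := 2) fun h h' => ?_).continuous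
    rw [dist_eq_norm, dist_eq_norm]
    refine lp.norm_le_of_forall_le (by positivity) fun n => ?_
    have h1 : (DirichletForm.toBounded (toBoundedDomain h) -
        DirichletForm.toBounded (toBoundedDomain h')) n = ((eval (h - h') n : ℝ) : ℂ) := by
      change ((eval h n : ℝ) : ℂ) - ((eval h' n : ℝ) : ℂ) = _
      rw [← Complex.ofReal_sub]
      simp only [eval, lp.coeFn_sub, Pi.sub_apply]
      congr 1
      ring
    rw [h1, Complex.norm_real]
    exact abs_eval_le _ n
  refine (isSeparable_univ.image hcont).mono ?_
  rintro _ ⟨f, rfl⟩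
  obtain ⟨h, rfl⟩ := exists_toBoundedDomain_eq f
  exact ⟨h, trivial, rfl⟩

/-- The constant function `1`. -/
noncomputable def one : dirichletForm.boundedDomain := toBoundedDomain (lp.single 2 none 1)

theorem one_apply (n : ℕ) : (one : ℕ → ℝ) n = 1 := by
  change eval (lp.single 2 none 1) n = 1
  simp [eval]

theorem mul_one_eq (f : dirichletForm.boundedDomain) : f * one = f := by
  refine Subtype.ext (funext fun n => ?_)
  change (f : ℕ → ℝ) n * (one : ℕ → ℝ) n = _
  rw [one_apply, mul_one]

theorem vanishesNowhere : dirichletForm.VanishesNowhere := fun n =>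
  ⟨one, by rw [one_apply]; exact one_ne_zero⟩

/-- For `f = 1` the right-hand side is `2 𝓔(φ, 1) - 𝓔(φ, 1) = 𝓔(φ, 1)`, the limit of `φ`. Indicators
of points have limit `0`, which forces `Γ = 0`; but `φ = 1` has limit `1`. -/
theorem not_admitsEnergyMeasures : ¬ dirichletForm.AdmitsEnergyMeasures := by
  intro hadm
  obtain ⟨Γ, hΓ⟩ := hadm one
  have key : ∀ h : ConvergentSeq, Integrable (eval h) Γ ∧ 2 * ∫ n, eval h n ∂Γ = h none := by
    intro h
    obtain ⟨h1, h2⟩ := hΓ (toBoundedDomain h)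
    refine ⟨h1, h2.trans ?_⟩
    rw [mul_one_eq, mul_one_eq, one, energy_toBoundedDomain, lp.inner_single_right]
    simp
    ring
  have hsingle : ∀ n : ℕ, eval (lp.single 2 (some n) 1) = Set.indicator {n} 1 := fun n => by
    funext m
    simp [eval, Pi.single_apply, Set.indicator_apply]
  have hzero : ∀ n : ℕ, Γ {n} = 0 := fun n => by
    obtain ⟨h1, h2⟩ := key (lp.single 2 (some n) 1)
    rw [hsingle] at h1 h2
    rw [integral_indicator_one (measurableSet_singleton n)] at h2
    have h3 : Γ.real {n} = 0 := by simpa using h2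
    -- A vanishing real-valued measure also permits `Γ {n} = ∞`; integrability of the indicator
    -- excludes this.
    refine (ENNReal.toReal_eq_zero_iff _).mp h3 |>.resolve_right ?_
    rw [integrable_indicator_iff (measurableSet_singleton n)] at h1
    exact (integrableOn_const_iff (C := (1 : ℝ)) |>.mp h1 |>.resolve_left (by simp)).ne
  have hΓ0 : Γ = 0 := by
    refine Measure.ext_of_singleton fun n => ?_
    rw [hzero n]
    rfl
  have h1 := (key (lp.single 2 none 1)).2
  rw [hΓ0, integral_zero_measure] at h1
  simp at h1

end ConvergentSeq

theorem theorem6p2 :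
    -- existence and uniqueness of the energy measures of the transferred form
    (∀ (X : Type*) [MeasurableSpace X] (μ : MeasureTheory.Measure X) (𝓔 : DirichletForm μ),
      𝓔.VanishesNowhere → 𝓔.SupSeparable →
      ∀ f : 𝓔.hatDomain, ∃! Γ : MeasureTheory.Measure 𝓔.Spectrum,
        MeasureTheory.IsFiniteMeasure Γ ∧ Γ.Regular ∧
        ∀ φ : 𝓔.hatDomain,
          2 * ∫ y, (φ : C₀(𝓔.Spectrum, ℝ)) y ∂Γ
            = 2 * DirichletForm.hatEnergy (φ * f) f - DirichletForm.hatEnergy φ (f * f)) ∧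
    -- the original form need not admit energy measures
    (∃ (X : Type) (_ : MeasurableSpace X) (μ : MeasureTheory.Measure X) (𝓔 : DirichletForm μ),
      𝓔.VanishesNowhere ∧ 𝓔.SupSeparable ∧ ¬ 𝓔.AdmitsEnergyMeasures) :=
  ⟨fun _ _ _ _ _ _ f => DirichletForm.existsUnique_hatEnergyMeasure f,
    ℕ, inferInstance, weightedNat, ConvergentSeq.dirichletForm, ConvergentSeq.vanishesNowhere,
    ConvergentSeq.supSeparable, ConvergentSeq.not_admitsEnergyMeasures⟩
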